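/- Fix rates $\lambda>0$, $\mu>0$, $\Gamma\ge 0$ and probabilities $q,p\in[0,1]$. The 1G1B system is the continuous-time Markov chain $s(t)$ on $\{\emptyset,0,1,2,\dots\}$ with $s(0)=\emptyset$ and transition rates $\lambda$ from $\emptyset$ to $0$, $\lambda q p$ from $i$ to $i+1$, and $\mu+\lambda q(1-p)$ from $i$ to $\emptyset$ (for every $i\ge 0$), all other rates being zero. Let $\rho_{\mathrm{new}}$ be a two-qubit state with fidelity $F_{\mathrm{new}}=\langle\phi^+|\rho_{\mathrm{new}}|\phi^+\rangle$, where $|\phi^+\rangle=(|00\rangle+|11\rangle)/\sqrt2$, and let the jump function be linear, $J(F,\rho_{\mathrm{new}})=aF+b$ with $a,b\in\mathbb R$ such that $aF+b\in[0,1]$ for all $F\in[0,1]$. Put $D_t[F]=e^{-\Gamma t}(F-\tfrac14)+\tfrac14$ and define $$F^{(0)}(t_0)=D_{t_0}[F_{\mathrm{new}}],\qquad F^{(i)}(t_0,\dots,t_i)=D_{t_i}\big[J(F^{(i-1)}(t_0,\dots,t_{i-1}),\rho_{\mathrm{new}})\big]\quad(i\ge1).$$ The fidelity of the system at time $t$ is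 $F(t)=0$ if $s(t)=\emptyset$, and $F(t)=F^{(i)}(T_0(t),\dots,T_i(t))$ if $s(t)=i\ge0$, where $T_j(t)$, for $j<i$, is the time spent in the most recent visit to state $j$, and $T_i(t)$ is the time spent so far in the current visit to state $i$. Let $\alpha=\mu+\lambda q$ and $\gamma=\alpha/(\alpha+\Gamma)$. Then, for every $i\ge 0$, the average fidelity after $i$ purification rounds, $c_i=\mathbb E\big[F^{(i)}(Q_0,\dots,Q_i)\big]$ with $Q_0,\dots,Q_i$ i.i.d. exponential random variables of rate $\alpha$, is $$c_i=\frac14+\Big(F_{\mathrm{new}}-\frac14\Big)a^i\gamma^{i+1}+\Big(\frac a4+b-\frac14\Big)\gamma\,\frac{1-a^i\gamma^i}{1-a\gamma},$$ where the last term is read as $0$ if $a\gamma=1$ (this happens only for $\Gamma=0$, $a=1$, $b=0$, when the factor $\frac a4+b-\frac14$ vanishes). Moreover, the average consumed fidelity $\overline F=\lim_{t\to\infty}\mathbb E[F(t)\mid s(t)\ne\emptyset]$ exists and equals $$\overline F=\frac{\frac14\Gamma+b\lambda qp+F_{\mathrm{new}}\big(\mu+\lambda q(1-p)\big)}{\Gamma+\mu+\lambda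 q(1-pa)}.$$ -/

import Mathlib

open MeasureTheory ProbabilityTheory

noncomputable section

namespace Buffer

/-! ### Two-qubit states and their fidelity -/

open scoped ComplexOrder in
/-- A two-qubit density matrix, in the computational basis. -/
structure TwoQubitState where
  mat : Matrix (Fin 2 × Fin 2) (Fin 2 × Fin 2) ℂ
  posSemidef : mat.PosSemidef
  trace_eq_one : mat.trace = 1

/-- The Bell vector `(|00⟩ + |11⟩) / √2`. -/
def phiPlus : Fin 2 × Fin 2 → ℂ :=
  fun x => if x.1 = x.2 then ((1 / Real.sqrt 2 : ℝ) : ℂ) else 0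

/-- The fidelity `⟨φ⁺| ρ |φ⁺⟩` of a two-qubit state to the Bell state. -/
def TwoQubitState.fidelity (ρ : TwoQubitState) : ℝ :=
  (star phiPlus ⬝ᵥ ρ.mat.mulVec phiPlus).re

/-! ### Decoherence and pumping along a sequence of purification levels -/

/-- Depolarising noise of rate `Γ` acting on a fidelity for a time `t`. -/
def depol (Γ t F : ℝ) : ℝ := Real.exp (-Γ * t) * (F - 1 / 4) + 1 / 4

/-- The fidelity `F^{(i)}(t₀, …, tᵢ)` after spending times `t₀, …, tᵢ` in the purification levels
`0, …, i`, for the jump function `J` and new links in the state `ρ`. -/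
def levelFidelity (Γ : ℝ) (J : ℝ → TwoQubitState → ℝ) (ρ : TwoQubitState) :
    (i : ℕ) → (Fin (i + 1) → ℝ) → ℝ
  | 0, t => depol Γ (t 0) ρ.fidelity
  | i + 1, t =>
      depol Γ (t (Fin.last (i + 1))) (J (levelFidelity Γ J ρ i (fun j => t j.castSucc)) ρ)

/-- The joint law of `Q₀, …, Qᵢ`, i.i.d. exponential with rate `r`. -/
def iidExp (r : ℝ) (i : ℕ) : Measure (Fin (i + 1) → ℝ) :=
  Measure.pi (fun _ => expMeasure r)

/-- `c_i = 𝔼[F^{(i)}(Q₀, …, Qᵢ)]` with `Q₀, …, Qᵢ` i.i.d. exponential with rate `μ + λ q`. -/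
def avgLevelFidelity (lam mu q Γ : ℝ) (J : ℝ → TwoQubitState → ℝ) (ρ : TwoQubitState) (i : ℕ) :
    ℝ :=
  ∫ t, levelFidelity Γ J ρ i t ∂(iidExp (mu + lam * q) i)

/-! ### Continuous-time Markov chains through the jump chain and the holding times -/

section CTMC

variable {S : Type*} [DecidableEq S] {Ω : Type*} [MeasurableSpace Ω]

/-- Total rate of leaving `x`, for transition rates `R` that vanish on the diagonal. -/
def exitRate (R : S → S → ℝ) (x : S) : ℝ := ∑' y, R x y

/-- Probability that a jump out of `x` leads to `y`. -/
def jumpProb (R : S → S → ℝ) (x y : S) : ℝ := R x y / exitRate R x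

/-- `Y` and `H` are the jump chain and the holding times of a continuous-time Markov chain with
transition rates `R`, started in `x₀`: `Y` is a Markov chain with transition matrix `jumpProb R`
and, given `Y`, the `H k` are independent and exponential with rates `exitRate R (Y k)`. -/
structure IsCTMC (R : S → S → ℝ) (x₀ : S) (P : Measure Ω) (Y : ℕ → Ω → S) (H : ℕ → Ω → ℝ) :
    Prop where
  measurableSet_Y : ∀ n x, MeasurableSet {ω | Y n ω = x}
  measurable_H : ∀ n, Measurable (H n)
  law : ∀ (n : ℕ) (y : ℕ → S) (B : ℕ → Set ℝ), (∀ k, MeasurableSet (B k)) →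
    P {ω | ∀ k ≤ n, Y k ω = y k ∧ H k ω ∈ B k} =
      (if y 0 = x₀ then 1 else 0) *
        (∏ k ∈ Finset.range n, ENNReal.ofReal (jumpProb R (y k) (y (k + 1)))) *
        ∏ k ∈ Finset.range (n + 1), expMeasure (exitRate R (y k)) (B k)

/-- Time of the `n`-th jump; `Y n` is entered at this time. -/
def jumpTime (H : ℕ → Ω → ℝ) (n : ℕ) (ω : Ω) : ℝ := ∑ k ∈ Finset.range n, H k ω

/-- Number of jumps up to and including time `t`. -/
def jumpCount (H : ℕ → Ω → ℝ) (t : ℝ) (ω : Ω) : ℕ := sSup {n | jumpTime H n ω ≤ t}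

/-- State at time `t`. -/
def stateAt (Y : ℕ → Ω → S) (H : ℕ → Ω → ℝ) (t : ℝ) (ω : Ω) : S := Y (jumpCount H t ω) ω

end CTMC

/-! ### The 1G1B system

The states are `none` (no link in the good memory) and `some i` (a link that is the result of `i`
successful pumping rounds). -/

/-- Transition rates of the 1G1B system. -/
def bufferRate (lam mu q p : ℝ) : Option ℕ → Option ℕ → ℝ
  | none, none => 0
  | none, some j => if j = 0 then lam else 0
  | some _, none => mu + lam * q * (1 - p)
  | some i, some j => if j = i + 1 then lam * q * p else 0

section System

variable {Ω : Type*} [MeasurableSpace Ω]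

/-- The 1G1B system, which starts without a link. -/
def Is1G1B (lam mu q p : ℝ) (P : Measure Ω) (Y : ℕ → Ω → Option ℕ) (H : ℕ → Ω → ℝ) : Prop :=
  IsCTMC (bufferRate lam mu q p) none P Y H

/-- The vector of times spent in the levels `0, …, i`, when the state at time `t` is `some i`:
for `j < i` the duration of the most recent visit to level `j`, and for `j = i` the time spent
so far in level `i`. -/
def levelTimes (Y : ℕ → Ω → Option ℕ) (H : ℕ → Ω → ℝ) (t : ℝ) (ω : Ω) (i : ℕ) :
    Fin (i + 1) → ℝ :=
  fun j =>
    if (j : ℕ) = i then t - jumpTime H (jumpCount H t ω) ω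
    else H (Nat.findGreatest (fun m => Y m ω = some (j : ℕ)) (jumpCount H t ω)) ω

/-- The fidelity `F(t)` of the system at time `t` (zero if there is no link). -/
def systemFidelity (Γ : ℝ) (J : ℝ → TwoQubitState → ℝ) (ρ : TwoQubitState)
    (Y : ℕ → Ω → Option ℕ) (H : ℕ → Ω → ℝ) (t : ℝ) (ω : Ω) : ℝ :=
  match stateAt Y H t ω with
  | none => 0
  | some i => levelFidelity Γ J ρ i (levelTimes Y H t ω i)

/-- `𝔼[F(t) | s(t) ≠ ∅]`. -/
def condMeanFidelity (Γ : ℝ) (J : ℝ → TwoQubitState → ℝ) (ρ : TwoQubitState) (P : Measure Ω)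
    (Y : ℕ → Ω → Option ℕ) (H : ℕ → Ω → ℝ) (t : ℝ) : ℝ :=
  ∫ ω, systemFidelity Γ J ρ Y H t ω ∂(P[|{ω | stateAt Y H t ω ≠ none}])

/-- `L` is the average consumed fidelity: the limit of `𝔼[F(t) | s(t) ≠ ∅]` as `t → ∞`. -/
def IsAvgConsumedFidelity (Γ : ℝ) (J : ℝ → TwoQubitState → ℝ) (ρ : TwoQubitState)
    (P : Measure Ω) (Y : ℕ → Ω → Option ℕ) (H : ℕ → Ω → ℝ) (L : ℝ) : Prop :=
  (∀ t, Integrable (systemFidelity Γ J ρ Y H t) P) ∧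
    Filter.Tendsto (condMeanFidelity Γ J ρ P Y H) Filter.atTop (nhds L)

end System

end Buffer

end

/-! Write `α = μ + λq`, `β = μ + λq(1 - p)`, `ν = λqp`. All levels have the same exit rate `α` and
the same chance `ν / α` of moving up, decoherence shrinks `F - 1/4` exponentially, and the jump
function is affine. These facts make the problem linear and let the level drop out of it.

For the level averages, the last time `Q_{i+1}` is independent of the earlier ones and `E[exp(-ΓQ)]
= γ`. Hence `c_{i+1} = γ (a c_i + b - 1/4) + 1/4`, and iterating gives a geometric sum
(`levelFidelity_succ_average`, `levelFidelity_average`).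

For the limit, let `O` and `L` be the probabilities of having no link and a link at time `t`, and
let `M` be the mean of `F(t) - 1/4` on the event that there is a link. They solve the closed system
`O' = -λO + βL`, `L' = -αL + λO + νL`, `M' = -(α + Γ)M + λ(F_new - 1/4)O + ν(aM + (a/4 + b -
1/4)L)`. The system is derived in integrated form. The part of `O`, `L` or `M` belonging to exactly
`n` jumps is the mean of an exponential kernel taken at the `n`-th jump time. The Markov property at
that jump (`IsCTMC.measure_inter`, `IsCTMC.setIntegral_step`) expresses the part `n + 1` by
convolutions of the parts `n`, and summing over `n` gives the three equations
(`isResponse_totalEmpty`, `isResponse_totalLink`, `isResponse_totalExcess`).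

The analysis of the system rests on one device: the resolvent identity allows the decay rate of an
equation to be changed at the price of a term in the source (`IsResponse.shift`). A small common
rate for `O` and `L` yields `O + L = 1`, that is, non-explosion. Rates that cancel the unknown in
its own source yield the limits of `L` and `M`. Since `E[F(t) | s(t) ≠ ∅] = 1/4 + M/L`, the answer
is `1/4` plus the quotient of these limits. -/

noncomputable section

namespace Buffer

/-! ### The history σ-algebra and the Markov property at a jump. -/

section History

variable {S : Type*} [DecidableEq S] {Ω : Type*} [MeasurableSpace Ω]

/-- The event that the jump chain follows `y` up to step `n` and that the holding times before
step `n` lie in the sets `B k`. -/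
def histCylinder (Y : ℕ → Ω → S) (H : ℕ → Ω → ℝ) (n : ℕ) (y : ℕ → S) (B : ℕ → Set ℝ) : Set Ω :=
  {ω | (∀ k ≤ n, Y k ω = y k) ∧ ∀ k < n, H k ω ∈ B k}

/-- The cylinders that generate the history at step `n`. -/
def histCylinders (Y : ℕ → Ω → S) (H : ℕ → Ω → ℝ) (n : ℕ) : Set (Set Ω) :=
  {A | ∃ (y : ℕ → S) (B : ℕ → Set ℝ), (∀ k, MeasurableSet (B k)) ∧ A = histCylinder Y H n y B}

/-- The history at step `n`: the σ-algebra of `Y 0, …, Y n` and `H 0, …, H (n - 1)`. -/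
@[reducible] def hist (Y : ℕ → Ω → S) (H : ℕ → Ω → ℝ) (n : ℕ) : MeasurableSpace Ω :=
  MeasurableSpace.generateFrom (histCylinders Y H n)

-- Two cylinders that meet prescribe the same path up to step `n`, so only their holding-time sets
-- have to be intersected.
omit [DecidableEq S] [MeasurableSpace Ω] in
lemma isPiSystem_histCylinders (Y : ℕ → Ω → S) (H : ℕ → Ω → ℝ) (n : ℕ) :
    IsPiSystem (histCylinders Y H n) := by
  rintro _ ⟨y, B, hB, rfl⟩ _ ⟨y', B', hB', rfl⟩ ⟨ω, hω, hω'⟩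
  refine ⟨y, fun k => B k ∩ B' k, fun k => (hB k).inter (hB' k), ?_⟩
  have hy : ∀ k ≤ n, y k = y' k := fun k hk => (hω.1 k hk).symm.trans (hω'.1 k hk)
  ext ω'
  constructor
  · rintro ⟨h, h'⟩
    exact ⟨h.1, fun k hk => ⟨h.2 k hk, h'.2 k hk⟩⟩
  · rintro ⟨h, h'⟩
    exact ⟨⟨h, fun k hk => (h' k hk).1⟩, fun k hk => (h k hk).trans (hy k hk),
      fun k hk => (h' k hk).2⟩

/-- Continue a finite path by a constant. -/
def extendPath {n : ℕ} (x : S) (y : Fin (n + 1) → S) (k : ℕ) : S :=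
  if h : k < n + 1 then y ⟨k, h⟩ else x

-- Only the first `n + 1` values of a path matter. Indexing by `Fin (n + 1) → S` makes this union
-- countable for countable `S`, unlike indexing by `ℕ → S`.
omit [DecidableEq S] [MeasurableSpace Ω] in
lemma iUnion_histCylinder (Y : ℕ → Ω → S) (H : ℕ → Ω → ℝ) (n : ℕ) (x : S) (B : ℕ → Set ℝ) :
    ⋃ y : Fin (n + 1) → S, histCylinder Y H n (extendPath x y) B =
      {ω | ∀ k < n, H k ω ∈ B k} := by
  ext ω
  simp only [Set.mem_iUnion, histCylinder, Set.mem_ofPred_eq]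
  constructor
  · rintro ⟨y, -, h⟩
    exact h
  · intro h
    refine ⟨fun k => Y k ω, fun k hk => ?_, h⟩
    simp [extendPath, Nat.lt_succ_of_le hk]

omit [DecidableEq S] [MeasurableSpace Ω] in
lemma measurableSet_histCylinder (Y : ℕ → Ω → S) (H : ℕ → Ω → ℝ) (n : ℕ) (y : ℕ → S)
    {B : ℕ → Set ℝ} (hB : ∀ k, MeasurableSet (B k)) :
    MeasurableSet[hist Y H n] (histCylinder Y H n y B) :=
  MeasurableSpace.measurableSet_generateFrom ⟨y, B, hB, rfl⟩

omit [DecidableEq S] [MeasurableSpace Ω] in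
lemma measurableSet_hist_Y [Countable S] (Y : ℕ → Ω → S) (H : ℕ → Ω → ℝ) {n k : ℕ} (hk : k ≤ n)
    (C : Set S) : MeasurableSet[hist Y H n] {ω | Y k ω ∈ C} := by
  have : {ω | Y k ω ∈ C} = ⋃ y : {y : Fin (n + 1) → S // y ⟨k, Nat.lt_succ_of_le hk⟩ ∈ C},
      histCylinder Y H n (extendPath (y.1 0) y.1) (fun _ => Set.univ) := by
    ext ω
    simp only [Set.mem_iUnion, histCylinder, Set.mem_ofPred_eq]
    constructor
    · intro h
      refine ⟨⟨fun k => Y k ω, h⟩, fun j hj => ?_, fun _ _ => trivial⟩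
      simp [extendPath, Nat.lt_succ_of_le hj]
    · rintro ⟨⟨y, hy⟩, h, -⟩
      rw [h k hk]
      simpa [extendPath, Nat.lt_succ_of_le hk] using hy
  rw [this]
  exact MeasurableSet.iUnion fun y =>
    measurableSet_histCylinder Y H n _ (fun _ => MeasurableSet.univ)

omit [DecidableEq S] [MeasurableSpace Ω] in
lemma measurable_hist_H [Countable S] (Y : ℕ → Ω → S) (H : ℕ → Ω → ℝ) {n k : ℕ} (hk : k < n) :
    Measurable[hist Y H n] (H k) := by
  intro B hB
  rcases isEmpty_or_nonempty S with hS | ⟨⟨x⟩⟩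
  · have : IsEmpty Ω := ⟨fun ω => hS.elim (Y 0 ω)⟩
    rw [Set.eq_empty_of_isEmpty (H k ⁻¹' B)]
    exact @MeasurableSet.empty _ (hist Y H n)
  have : H k ⁻¹' B = ⋃ y : Fin (n + 1) → S,
      histCylinder Y H n (extendPath x y) (fun j => if j = k then B else Set.univ) := by
    rw [iUnion_histCylinder]
    ext ω
    simp only [Set.mem_preimage, Set.mem_ofPred_eq]
    constructor
    · intro h j _
      by_cases hj : j = k
      · subst hj; simpa using h
      · simp [hj]
    · intro h
      simpa using h k hk
  rw [this]
  refine MeasurableSet.iUnion fun y => measurableSet_histCylinder Y H n _ (fun j => ?_)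
  split_ifs
  exacts [hB, MeasurableSet.univ]

omit [DecidableEq S] [MeasurableSpace Ω] in
lemma hist_le_of_measurable {m : MeasurableSpace Ω} {Y : ℕ → Ω → S} {H : ℕ → Ω → ℝ} {n : ℕ}
    (hY : ∀ k ≤ n, ∀ x, MeasurableSet[m] {ω | Y k ω = x}) (hH : ∀ k < n, Measurable[m] (H k)) :
    hist Y H n ≤ m := by
  refine MeasurableSpace.generateFrom_le ?_
  rintro _ ⟨y, B, hB, rfl⟩
  have : histCylinder Y H n y B =
      (⋂ k, ⋂ _ : k ≤ n, {ω | Y k ω = y k}) ∩ ⋂ k, ⋂ _ : k < n, H k ⁻¹' B k := by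
    ext ω
    simp [histCylinder]
  rw [this]
  exact (MeasurableSet.iInter fun k => MeasurableSet.iInter fun hk => hY k hk _).inter
    (MeasurableSet.iInter fun k => MeasurableSet.iInter fun hk => hH k hk (hB k))

omit [DecidableEq S] [MeasurableSpace Ω] in
lemma hist_mono [Countable S] (Y : ℕ → Ω → S) (H : ℕ → Ω → ℝ) (n : ℕ) :
    hist Y H n ≤ hist Y H (n + 1) :=
  hist_le_of_measurable (fun _ hk x => measurableSet_hist_Y Y H (Nat.le_succ_of_le hk) {x})
    (fun _ hk => measurable_hist_H Y H (Nat.lt_succ_of_lt hk))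

variable {R : S → S → ℝ} {x₀ : S} {P : Measure Ω} {Y : ℕ → Ω → S} {H : ℕ → Ω → ℝ}

lemma IsCTMC.hist_le (hC : IsCTMC R x₀ P Y H) (n : ℕ) : hist Y H n ≤ ‹MeasurableSpace Ω› :=
  hist_le_of_measurable (fun k _ x => hC.measurableSet_Y k x) (fun k _ => hC.measurable_H k)

lemma IsCTMC.measurableSet_mem [Countable S] (hC : IsCTMC R x₀ P Y H) (n : ℕ) (C : Set S) :
    MeasurableSet {ω | Y n ω ∈ C} :=
  hC.hist_le n _ (measurableSet_hist_Y Y H le_rfl C)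

/-- The law in `IsCTMC` also constrains the holding time at step `n`; leaving it free costs a factor
`1`, because the exponential law of positive rate is a probability measure. -/
lemma IsCTMC.measure_histCylinder (hC : IsCTMC R x₀ P Y H) (hR : ∀ x, 0 < exitRate R x) (n : ℕ)
    (y : ℕ → S) {B : ℕ → Set ℝ} (hB : ∀ k, MeasurableSet (B k)) :
    P (histCylinder Y H n y B) = (if y 0 = x₀ then 1 else 0) *
        (∏ k ∈ Finset.range n, ENNReal.ofReal (jumpProb R (y k) (y (k + 1)))) *
        ∏ k ∈ Finset.range n, expMeasure (exitRate R (y k)) (B k) := by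
  have h := hC.law n y (fun k => if k < n then B k else Set.univ) (fun k => by
    split_ifs; exacts [hB k, MeasurableSet.univ])
  have hset : {ω | ∀ k ≤ n, Y k ω = y k ∧ H k ω ∈ (if k < n then B k else Set.univ)} =
      histCylinder Y H n y B := by
    ext ω
    simp only [Set.mem_ofPred_eq, histCylinder]
    constructor
    · intro h
      exact ⟨fun k hk => (h k hk).1, fun k hk => by simpa [hk] using (h k hk.le).2⟩
    · rintro ⟨h, h'⟩ k hk
      refine ⟨h k hk, ?_⟩
      split_ifs with hkn
      exacts [h' k hkn, trivial]
  have := isProbabilityMeasure_expMeasure (hR (y n))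
  rw [hset] at h
  rw [h, Finset.prod_range_succ _ n]
  simp only [lt_self_iff_false, if_false, measure_univ, mul_one]
  congr 1
  exact Finset.prod_congr rfl fun k hk => by simp [Finset.mem_range.1 hk]

lemma IsCTMC.measure_histCylinder_inter (hC : IsCTMC R x₀ P Y H) (hR : ∀ x, 0 < exitRate R x)
    (n : ℕ) (y : ℕ → S) {B : ℕ → Set ℝ} (hB : ∀ k, MeasurableSet (B k)) {D : Set ℝ}
    (hD : MeasurableSet D) (x : S) :
    P (histCylinder Y H n y B ∩ {ω | H n ω ∈ D} ∩ {ω | Y (n + 1) ω = x}) =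
      P (histCylinder Y H n y B) *
        (expMeasure (exitRate R (y n)) D * ENNReal.ofReal (jumpProb R (y n) x)) := by
  have h := hC.measure_histCylinder hR (n + 1) (Function.update y (n + 1) x)
    (B := Function.update B n D) (fun k => by
      by_cases hk : k = n
      · subst hk; simpa using hD
      · simpa [hk] using hB k)
  have hset : histCylinder Y H (n + 1) (Function.update y (n + 1) x) (Function.update B n D) =
      histCylinder Y H n y B ∩ {ω | H n ω ∈ D} ∩ {ω | Y (n + 1) ω = x} := by
    ext ω
    simp only [histCylinder, Set.mem_inter_iff, Set.mem_ofPred_eq]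
    constructor
    · rintro ⟨h, h'⟩
      refine ⟨⟨⟨fun k hk => ?_, fun k hk => ?_⟩, ?_⟩, ?_⟩
      · simpa [show k ≠ n + 1 by omega] using h k (by omega)
      · simpa [show k ≠ n by omega] using h' k (by omega)
      · simpa using h' n (by omega)
      · simpa using h (n + 1) le_rfl
    · rintro ⟨⟨⟨h, h'⟩, h''⟩, h'''⟩
      refine ⟨fun k hk => ?_, fun k hk => ?_⟩
      · by_cases hkn : k = n + 1
        · subst hkn; simpa using h'''
        · simpa [hkn] using h k (by omega)
      · by_cases hkn : k = n
        · subst hkn; simpa using h''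
        · simpa [hkn] using h' k (by omega)
  rw [hset] at h
  rw [h, hC.measure_histCylinder hR n y hB, Finset.prod_range_succ _ n, Finset.prod_range_succ _ n]
  have e1 : ∏ k ∈ Finset.range n, ENNReal.ofReal (jumpProb R (Function.update y (n + 1) x k)
      (Function.update y (n + 1) x (k + 1))) =
      ∏ k ∈ Finset.range n, ENNReal.ofReal (jumpProb R (y k) (y (k + 1))) := by
    refine Finset.prod_congr rfl fun k hk => ?_
    have := Finset.mem_range.1 hk
    rw [Function.update_of_ne (by omega), Function.update_of_ne (by omega)]
  have e2 : ∏ k ∈ Finset.range n, expMeasure (exitRate R (Function.update y (n + 1) x k))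
      (Function.update B n D k) =
      ∏ k ∈ Finset.range n, expMeasure (exitRate R (y k)) (B k) := by
    refine Finset.prod_congr rfl fun k hk => ?_
    have := Finset.mem_range.1 hk
    rw [Function.update_of_ne (by omega), Function.update_of_ne (by omega)]
  rw [e1, e2]
  rw [Function.update_of_ne (by omega : (0 : ℕ) ≠ n + 1), Function.update_of_ne (by omega : n ≠ n + 1)]
  simp only [Function.update_self]
  ring

/-- Given that `Y n` lies in a class `C` of states with common exit rate `r` and common probability
`c` to jump into `C'`, the history, the holding time and the event `Y (n + 1) ∈ C'` are
independent. -/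
lemma IsCTMC.measure_inter [Countable S] [IsFiniteMeasure P] (hC : IsCTMC R x₀ P Y H)
    (hR : ∀ x, 0 < exitRate R x) (n : ℕ) {C C' : Set S} {r : ℝ} {c : ENNReal}
    (hr : ∀ x ∈ C, exitRate R x = r)
    (hc : ∀ x ∈ C, ∑' x' : C', ENNReal.ofReal (jumpProb R x x') = c)
    {D : Set ℝ} (hD : MeasurableSet D) {A : Set Ω} (hA : MeasurableSet[hist Y H n] A) :
    P (A ∩ ({ω | Y n ω ∈ C} ∩ {ω | H n ω ∈ D} ∩ {ω | Y (n + 1) ω ∈ C'})) =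
      P (A ∩ {ω | Y n ω ∈ C}) * (expMeasure r D * c) := by
  have hmC := hC.measurableSet_mem n C
  have hmD : MeasurableSet {ω | H n ω ∈ D} := hC.measurable_H n hD
  have hmC' := hC.measurableSet_mem (n + 1) C'
  have hcyl : ∀ s ∈ histCylinders Y H n,
      P (s ∩ ({ω | Y n ω ∈ C} ∩ {ω | H n ω ∈ D} ∩ {ω | Y (n + 1) ω ∈ C'})) =
      P (s ∩ {ω | Y n ω ∈ C}) * (expMeasure r D * c) := by
    rintro _ ⟨y, B, hB, rfl⟩
    by_cases hy : y n ∈ C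
    · have h1 : histCylinder Y H n y B ∩ {ω | Y n ω ∈ C} = histCylinder Y H n y B :=
        Set.inter_eq_left.2 fun ω hω => by
          simpa only [Set.mem_ofPred_eq, hω.1 n le_rfl] using hy
      rw [Set.inter_assoc {ω | Y n ω ∈ C}, ← Set.inter_assoc, h1, ← Set.inter_assoc]
      have h2 : histCylinder Y H n y B ∩ {ω | H n ω ∈ D} ∩ {ω | Y (n + 1) ω ∈ C'} =
          ⋃ x : C', histCylinder Y H n y B ∩ {ω | H n ω ∈ D} ∩ {ω | Y (n + 1) ω = x} := by
        ext ω
        simp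
      rw [h2, measure_iUnion]
      · simp_rw [hC.measure_histCylinder_inter hR n y hB hD]
        rw [ENNReal.tsum_mul_left, ENNReal.tsum_mul_left, hc _ hy, hr _ hy]
      · intro x x' hxx'
        refine Set.disjoint_left.2 fun ω h h' => hxx' (Subtype.ext ?_)
        exact h.2.symm.trans h'.2
      · exact fun x => ((hC.hist_le n _ (measurableSet_histCylinder Y H n y hB)).inter hmD).inter
          (hC.measurableSet_Y _ _)
    · have h1 : histCylinder Y H n y B ∩ {ω | Y n ω ∈ C} = ∅ := by
        refine Set.eq_empty_of_forall_notMem fun ω hω => hy ?_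
        have := hω.2
        simpa only [Set.mem_ofPred_eq, hω.1.1 n le_rfl] using this
      rw [Set.inter_assoc {ω | Y n ω ∈ C}, ← Set.inter_assoc, h1]
      simp
  have hm := hC.hist_le n
  -- The identity extends from cylinders to the whole history by uniqueness of measures on `hist Y H
  -- n`, hence the `trim`.
  have key : (P.restrict ({ω | Y n ω ∈ C} ∩ {ω | H n ω ∈ D} ∩ {ω | Y (n + 1) ω ∈ C'})).trim hm =
      (expMeasure r D * c) • (P.restrict {ω | Y n ω ∈ C}).trim hm := by
    rcases isEmpty_or_nonempty S with hS | ⟨⟨x⟩⟩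
    · have : IsEmpty Ω := ⟨fun ω => hS.elim (Y 0 ω)⟩
      refine @Measure.ext _ (hist Y H n) _ _ fun s _ => ?_
      rw [Set.eq_empty_of_isEmpty s]
      simp
    -- The whole space need not be a cylinder, so uniqueness uses a countable cover: one cylinder
    -- for each finite path, with unrestricted holding times.
    refine @Measure.ext_of_generateFrom_of_cover_subset _ (hist Y H n) _ _ (histCylinders Y H n)
      (Set.range fun y : Fin (n + 1) → S =>
        histCylinder Y H n (extendPath x y) (fun _ => Set.univ)) rfl
      (isPiSystem_histCylinders Y H n) ?_ (Set.countable_range _) ?_ ?_ ?_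
    · rintro _ ⟨y, rfl⟩
      exact ⟨_, _, fun _ => MeasurableSet.univ, rfl⟩
    · rw [Set.sUnion_range, iUnion_histCylinder]
      simp
    · intro s _
      exact measure_ne_top _ _
    · intro s hs
      have hs' : MeasurableSet[hist Y H n] s := MeasurableSpace.measurableSet_generateFrom hs
      rw [Measure.smul_apply, trim_measurableSet_eq hm hs', trim_measurableSet_eq hm hs',
        Measure.restrict_apply (hm _ hs'), Measure.restrict_apply (hm _ hs'), hcyl s hs,
        smul_eq_mul, mul_comm]
  have h := congrArg (fun μ => @DFunLike.coe _ _ _ _ μ A) key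
  simp only [Measure.smul_apply] at h
  rwa [trim_measurableSet_eq hm hA, trim_measurableSet_eq hm hA,
    Measure.restrict_apply (hm _ hA), Measure.restrict_apply (hm _ hA), smul_eq_mul,
    mul_comm] at h

/-- This is the independence in `IsCTMC.measure_inter` read as a product measure: any
history-measurable `X` and the next holding time are independent on the jump from `C` to `C'`, whose
conditional probability is `c`. -/
lemma IsCTMC.map_prodMk [Countable S] [IsFiniteMeasure P] (hC : IsCTMC R x₀ P Y H)
    (hR : ∀ x, 0 < exitRate R x) (n : ℕ) {C C' : Set S} {r c : ℝ} (hr0 : 0 < r)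
    (hr : ∀ x ∈ C, exitRate R x = r)
    (hc : ∀ x ∈ C, ∑' x' : C', ENNReal.ofReal (jumpProb R x x') = ENNReal.ofReal c) {E : Type*}
    [MeasurableSpace E] {X : Ω → E} (hX : Measurable[hist Y H n] X) :
    (P.restrict ({ω | Y n ω ∈ C} ∩ {ω | Y (n + 1) ω ∈ C'})).map (fun ω => (X ω, H n ω)) =
      ENNReal.ofReal c • ((P.restrict {ω | Y n ω ∈ C}).map X).prod (expMeasure r) := by
  have hX' : Measurable X := hX.mono (hC.hist_le n) le_rfl
  have := isProbabilityMeasure_expMeasure hr0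
  have hfin : IsFiniteMeasure (ENNReal.ofReal c • (P.restrict {ω | Y n ω ∈ C}).map X) :=
    Measure.smul_finite _ ENNReal.ofReal_ne_top
  rw [← Measure.prod_smul_left]
  refine (Measure.prod_eq fun s t hs ht => ?_).symm
  rw [Measure.map_apply (hX'.prodMk (hC.measurable_H n)) (hs.prod ht),
    Measure.restrict_apply ((hX'.prodMk (hC.measurable_H n)) (hs.prod ht)), Measure.smul_apply,
    Measure.map_apply hX' hs, Measure.restrict_apply (hX' hs)]
  have h := hC.measure_inter hR n hr hc ht (hX hs)
  have hset : (fun ω => (X ω, H n ω)) ⁻¹' s ×ˢ t ∩ ({ω | Y n ω ∈ C} ∩ {ω | Y (n + 1) ω ∈ C'}) =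
      X ⁻¹' s ∩ ({ω | Y n ω ∈ C} ∩ {ω | H n ω ∈ t} ∩ {ω | Y (n + 1) ω ∈ C'}) := by
    ext ω
    simp only [Set.mem_inter_iff, Set.mem_preimage, Set.mem_prod, Set.mem_ofPred_eq]
    tauto
  rw [hset, h, smul_eq_mul]
  ring

lemma IsCTMC.setIntegral_prodMk [Countable S] [IsFiniteMeasure P] (hC : IsCTMC R x₀ P Y H)
    (hR : ∀ x, 0 < exitRate R x) (n : ℕ) {C C' : Set S} {r c : ℝ} (hr0 : 0 < r) (hc0 : 0 ≤ c)
    (hr : ∀ x ∈ C, exitRate R x = r)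
    (hc : ∀ x ∈ C, ∑' x' : C', ENNReal.ofReal (jumpProb R x x') = ENNReal.ofReal c) {E : Type*}
    [MeasurableSpace E] {X : Ω → E} (hX : Measurable[hist Y H n] X) {f : E × ℝ → ℝ}
    (hf : Measurable f) {K : ℝ} (hK : ∀ z, |f z| ≤ K) :
    ∫ ω in {ω | Y n ω ∈ C} ∩ {ω | Y (n + 1) ω ∈ C'}, f (X ω, H n ω) ∂P =
      c * ∫ ω in {ω | Y n ω ∈ C}, ∫ h, f (X ω, h) ∂(expMeasure r) ∂P := by
  have hX' : Measurable X := hX.mono (hC.hist_le n) le_rfl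
  have := isProbabilityMeasure_expMeasure hr0
  have hmap := hC.map_prodMk hR n hr0 hr hc hX
  rw [← integral_map (φ := fun ω => (X ω, H n ω)) (f := f)
    (hX'.prodMk (hC.measurable_H n)).aemeasurable hf.aestronglyMeasurable, hmap,
    integral_smul_measure, ENNReal.toReal_ofReal hc0, smul_eq_mul, integral_prod]
  · rw [integral_map hX'.aemeasurable]
    exact (hf.stronglyMeasurable.integral_prod_right' (ν := expMeasure r)).aestronglyMeasurable
  · exact Integrable.of_bound hf.aestronglyMeasurable K (Filter.Eventually.of_forall hK)

end History

/-! ### Decay kernels and exponential times. -/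

/-- The decay kernel `exp (-κ u)` for `0 ≤ u`, continued by zero. -/
def decay (κ u : ℝ) : ℝ := if 0 ≤ u then Real.exp (-(κ * u)) else 0

lemma decay_of_nonneg {κ u : ℝ} (hu : 0 ≤ u) : decay κ u = Real.exp (-(κ * u)) := if_pos hu

lemma decay_of_neg {κ u : ℝ} (hu : u < 0) : decay κ u = 0 := if_neg hu.not_ge

lemma decay_nonneg (κ u : ℝ) : 0 ≤ decay κ u := by
  unfold decay
  split_ifs
  exacts [(Real.exp_pos _).le, le_rfl]

lemma decay_le_one {κ : ℝ} (hκ : 0 ≤ κ) (u : ℝ) : decay κ u ≤ 1 := by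
  unfold decay
  split_ifs with hu
  · exact Real.exp_le_one_iff.2 (neg_nonpos.2 (mul_nonneg hκ hu))
  · exact zero_le_one

lemma abs_decay_le_one {κ : ℝ} (hκ : 0 ≤ κ) (u : ℝ) : |decay κ u| ≤ 1 := by
  rw [abs_of_nonneg (decay_nonneg κ u)]
  exact decay_le_one hκ u

@[fun_prop]
lemma measurable_decay (κ : ℝ) : Measurable (decay κ) := by
  unfold decay
  exact Measurable.ite measurableSet_Ici (by fun_prop) measurable_const

lemma integrable_decay {κ : ℝ} (hκ : 0 < κ) : Integrable (decay κ) := by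
  have h : decay κ = Set.indicator (Set.Ici 0) (fun u => Real.exp (-κ * u)) := by
    ext u
    by_cases hu : 0 ≤ u
    · simp [decay, hu]
    · simp [decay, hu]
  rw [h, integrable_indicator_iff measurableSet_Ici, integrableOn_Ici_iff_integrableOn_Ioi]
  exact exp_neg_integrableOn_Ioi 0 hκ

lemma integrable_decay_sub {κ : ℝ} (hκ : 0 < κ) (t : ℝ) :
    Integrable (fun s => decay κ (t - s)) :=
  (integrable_decay hκ).comp_sub_left t

lemma integral_expMeasure {r : ℝ} (hr : 0 < r) (g : ℝ → ℝ) :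
    ∫ h, g h ∂(expMeasure r) = r * ∫ h, decay r h * g h := by
  have hpdf : gammaPDF 1 r = exponentialPDF r := rfl
  rw [expMeasure, gammaMeasure, hpdf, integral_withDensity_eq_integral_toReal_smul
    (show Measurable (exponentialPDF r) from (measurable_exponentialPDFReal r).ennreal_ofReal)
    (Filter.Eventually.of_forall fun _ => ENNReal.ofReal_lt_top), ← integral_const_mul]
  congr 1 with h
  rw [exponentialPDF_eq, ENNReal.toReal_ofReal, smul_eq_mul, decay]
  · split_ifs <;> ring
  · split_ifs
    exacts [(mul_pos hr (Real.exp_pos _)).le, le_rfl]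

lemma integral_decay {κ : ℝ} (hκ : 0 < κ) : ∫ u, decay κ u = 1 / κ := by
  have h := integral_expMeasure hκ (fun _ => 1)
  have := isProbabilityMeasure_expMeasure hκ
  simp only [integral_const, probReal_univ, smul_eq_mul, mul_one] at h
  field_simp
  linarith

lemma expMeasure_Iio {r : ℝ} : expMeasure r (Set.Iio 0) = 0 := by
  rw [expMeasure, gammaMeasure, withDensity_apply _ measurableSet_Iio]
  exact lintegral_gammaPDF_of_nonpos le_rfl

/-- The probability that an exponential time exceeds `u`, for `0 ≤ u`. -/
lemma integral_survival {r : ℝ} (hr : 0 < r) (u : ℝ) :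
    ∫ h, (if 0 ≤ u ∧ u < h then (1 : ℝ) else 0) ∂(expMeasure r) = decay r u := by
  have := isProbabilityMeasure_expMeasure hr
  by_cases hu : 0 ≤ u
  · have h1 : (fun h => if 0 ≤ u ∧ u < h then (1 : ℝ) else 0) =
        Set.indicator (Set.Iic u)ᶜ 1 := by
      ext h
      simp [Set.indicator_apply, hu]
    rw [h1, integral_indicator_one measurableSet_Iic.compl,
      probReal_compl_eq_one_sub measurableSet_Iic, ← cdf_eq_real, cdf_expMeasure_eq hr, if_pos hu,
      decay_of_nonneg hu]
    ring
  · simp [hu, decay_of_neg (not_le.1 hu)]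

/-- Convolution of an exponential time, discounted at rate `δ`, with a decay kernel. -/
lemma integral_discount_decay {r : ℝ} (hr : 0 < r) (δ κ t τ : ℝ) :
    ∫ h, Real.exp (-(δ * |h|)) * decay κ (t - (τ + h)) ∂(expMeasure r) =
      r * ∫ s, decay (r + δ) (s - τ) * decay κ (t - s) := by
  -- Substitution `s = τ + h`: the integration variable becomes the time of the next jump.
  rw [integral_expMeasure hr, ← integral_sub_right_eq_self _ τ]
  congr 2 with s
  have h2 : t - (τ + (s - τ)) = t - s := by ring
  rw [h2, ← mul_assoc]
  congr 1
  by_cases hs : 0 ≤ s - τ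
  · rw [decay_of_nonneg hs, decay_of_nonneg hs, abs_of_nonneg hs, ← Real.exp_add]
    congr 1
    ring
  · rw [decay_of_neg (not_le.1 hs), decay_of_neg (not_le.1 hs), zero_mul]

/-! ### One jump of the chain as a convolution with a kernel. -/

section Step

variable {S : Type*} [DecidableEq S] {Ω : Type*} [MeasurableSpace Ω]

/-- The expectation of `W · decay κ (t - T)` on the event that `Y n ∈ C`, where `T` is the time of
the `n`-th jump. -/
def decayMean (P : Measure Ω) (Y : ℕ → Ω → S) (H : ℕ → Ω → ℝ) (n : ℕ) (C : Set S) (W : Ω → ℝ)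
    (κ t : ℝ) : ℝ :=
  ∫ ω in {ω | Y n ω ∈ C}, W ω * decay κ (t - jumpTime H n ω) ∂P

variable {R : S → S → ℝ} {x₀ : S} {P : Measure Ω} {Y : ℕ → Ω → S} {H : ℕ → Ω → ℝ}

omit [DecidableEq S] [MeasurableSpace Ω] in
lemma measurable_hist_jumpTime [Countable S] (Y : ℕ → Ω → S) (H : ℕ → Ω → ℝ) (n : ℕ) :
    Measurable[hist Y H n] (jumpTime H n) := by
  exact @Finset.measurable_sum _ _ _ _ _ _ (hist Y H n) _ (Finset.range n)
    (fun k hk => measurable_hist_H Y H (Finset.mem_range.1 hk))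

lemma IsCTMC.measurable_jumpTime (hC : IsCTMC R x₀ P Y H) (n : ℕ) : Measurable (jumpTime H n) := by
  unfold jumpTime
  exact Finset.measurable_fun_sum _ fun k _ => hC.measurable_H k

/-- One step of the forward equation: the contribution to the kernel `decay κ (t - T)` at the
`(n + 1)`-st jump time `T` of the jumps from `C` to `C'`. -/
lemma IsCTMC.setIntegral_step [Countable S] [IsFiniteMeasure P] (hC : IsCTMC R x₀ P Y H)
    (hR : ∀ x, 0 < exitRate R x) (n : ℕ) {C C' : Set S} {r c : ℝ} (hr0 : 0 < r) (hc0 : 0 ≤ c)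
    (hr : ∀ x ∈ C, exitRate R x = r)
    (hc : ∀ x ∈ C, ∑' x' : C', ENNReal.ofReal (jumpProb R x x') = ENNReal.ofReal c)
    {W : Ω → ℝ} (hW : Measurable[hist Y H n] W) {K : ℝ} (hK : ∀ ω, |W ω| ≤ K) {δ κ : ℝ}
    (hδ : 0 ≤ δ) (hκ : 0 < κ) (t : ℝ) :
    ∫ ω in {ω | Y n ω ∈ C} ∩ {ω | Y (n + 1) ω ∈ C'},
        W ω * Real.exp (-(δ * |H n ω|)) * decay κ (t - jumpTime H (n + 1) ω) ∂P =
      c * r * ∫ s, decayMean P Y H n C W (r + δ) s * decay κ (t - s) := by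
  have hT := measurable_hist_jumpTime Y H n
  have hX : Measurable[hist Y H n] (fun ω => (W ω, jumpTime H n ω)) :=
    hW.prodMk hT
  have hW' : Measurable W := hW.mono (hC.hist_le n) le_rfl
  have hT' : Measurable (jumpTime H n) := hT.mono (hC.hist_le n) le_rfl
  -- The test function must be bounded on the whole product space, so its first coordinate is
  -- clamped to `[-|K|, |K|]`; on the values of `W` the clamp does nothing. The absolute value of
  -- the holding time serves the same purpose.
  have key := hC.setIntegral_prodMk hR n hr0 hc0 hr hc hX
    (f := fun z : (ℝ × ℝ) × ℝ => max (-|K|) (min |K| z.1.1) * (Real.exp (-(δ * |z.2|)) *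
      decay κ (t - (z.1.2 + z.2)))) (by fun_prop) (K := |K|) (fun z => by
      rw [abs_mul, abs_mul]
      have h1 : |max (-|K|) (min |K| z.1.1)| ≤ |K| := by
        rw [abs_le]
        exact ⟨le_max_left _ _, max_le (neg_le_self (abs_nonneg K)) (min_le_left _ _)⟩
      have h2 : |Real.exp (-(δ * |z.2|))| ≤ 1 := by
        rw [Real.abs_exp]
        exact Real.exp_le_one_iff.2 (neg_nonpos.2 (by positivity))
      have h3 := abs_decay_le_one hκ.le (t - (z.1.2 + z.2))
      calc _ ≤ |K| * (1 * 1) := by gcongr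
        _ = |K| := by ring)
  have hKW : ∀ ω, max (-|K|) (min |K| (W ω)) = W ω := fun ω => by
    have := abs_le.1 ((hK ω).trans (le_abs_self K))
    rw [min_eq_right this.2, max_eq_right this.1]
  simp only [hKW] at key
  have hjump : ∀ ω, jumpTime H (n + 1) ω = jumpTime H n ω + H n ω := fun ω => by
    simp [jumpTime, Finset.sum_range_succ]
  simp only [hjump, mul_assoc]
  rw [key]
  congr 1
  simp only [integral_const_mul, integral_discount_decay hr0]
  have hcomm : ∀ ω, W ω * (r * ∫ s, decay (r + δ) (s - jumpTime H n ω) * decay κ (t - s)) =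
      r * ∫ s, W ω * decay (r + δ) (s - jumpTime H n ω) * decay κ (t - s) := fun ω => by
    rw [mul_left_comm, ← integral_const_mul]
    simp only [mul_assoc]
  simp only [hcomm, integral_const_mul]
  -- Fubini moves the expectation inside the time integral, where it becomes `decayMean`; the factor
  -- `decay κ (t - s)` supplies integrability in `s`.
  rw [integral_integral_swap]
  · simp only [integral_mul_const, decayMean]
  · refine Integrable.mono' (g := fun z : Ω × ℝ => |K| * decay κ (t - z.2)) ?_ ?_ ?_
    · exact (integrable_const |K|).mul_prod (integrable_decay_sub hκ t)
    · exact Measurable.aestronglyMeasurable (by unfold Function.uncurry; fun_prop)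
    · refine Filter.Eventually.of_forall fun z => ?_
      simp only [Function.uncurry, Real.norm_eq_abs, abs_mul]
      have h1 := (hK z.1).trans (le_abs_self K)
      have h2 := abs_decay_le_one (add_nonneg hr0.le hδ) (z.2 - jumpTime H n z.1)
      rw [abs_of_nonneg (decay_nonneg κ (t - z.2))]
      have := decay_nonneg κ (t - z.2)
      calc _ ≤ |K| * 1 * decay κ (t - z.2) := by gcongr
        _ = _ := by ring

/-- The holding time in the `n`-th state outlives `t` with the probability given by the kernel. -/
lemma IsCTMC.setIntegral_survival [Countable S] [IsFiniteMeasure P] (hC : IsCTMC R x₀ P Y H)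
    (hR : ∀ x, 0 < exitRate R x) (n : ℕ) {C : Set S} {r : ℝ} (hr0 : 0 < r)
    (hr : ∀ x ∈ C, exitRate R x = r)
    (hc : ∀ x ∈ C, ∑' x', ENNReal.ofReal (jumpProb R x x') = 1)
    {W : Ω → ℝ} (hW : Measurable[hist Y H n] W) {K : ℝ} (hK : ∀ ω, |W ω| ≤ K) (t : ℝ) :
    ∫ ω in {ω | Y n ω ∈ C}, (if jumpTime H n ω ≤ t ∧ t < jumpTime H (n + 1) ω then W ω else 0) ∂P =
      decayMean P Y H n C W r t := by
  have hT := measurable_hist_jumpTime Y H n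
  have hX : Measurable[hist Y H n] (fun ω => (W ω, t - jumpTime H n ω)) :=
    hW.prodMk (measurable_const.sub hT)
  -- With every target allowed, the next state plays no role and `c = 1`.
  have key := hC.setIntegral_prodMk hR n (C' := Set.univ) hr0 zero_le_one hr (fun x hx => by
      rw [tsum_univ (fun x' => ENNReal.ofReal (jumpProb R x x')), hc x hx, ENNReal.ofReal_one]) hX
    (f := fun z : (ℝ × ℝ) × ℝ => max (-|K|) (min |K| z.1.1) *
      (if 0 ≤ z.1.2 ∧ z.1.2 < z.2 then 1 else 0)) (by
        refine Measurable.mul (by fun_prop) (Measurable.ite ?_ measurable_const measurable_const)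
        exact (measurableSet_le measurable_const measurable_fst.snd).inter
          (measurableSet_lt measurable_fst.snd measurable_snd)) (K := |K|) (fun z => by
      rw [abs_mul]
      have h1 : |max (-|K|) (min |K| z.1.1)| ≤ |K| := by
        rw [abs_le]
        exact ⟨le_max_left _ _, max_le (neg_le_self (abs_nonneg K)) (min_le_left _ _)⟩
      have h2 : |if 0 ≤ z.1.2 ∧ z.1.2 < z.2 then (1 : ℝ) else 0| ≤ 1 := by
        split_ifs <;> simp
      calc _ ≤ |K| * 1 := by gcongr
        _ = |K| := by ring)
  have hKW : ∀ ω, max (-|K|) (min |K| (W ω)) = W ω := fun ω => by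
    have := abs_le.1 ((hK ω).trans (le_abs_self K))
    rw [min_eq_right this.2, max_eq_right this.1]
  simp only [hKW, Set.mem_univ, one_mul] at key
  have hjump : ∀ ω, jumpTime H (n + 1) ω = jumpTime H n ω + H n ω := fun ω => by
    simp [jumpTime, Finset.sum_range_succ]
  simp only [integral_const_mul, integral_survival hr0] at key
  rw [decayMean, ← key]
  have hu : {ω : Ω | True} = Set.univ := by ext; simp
  rw [hu, Set.inter_univ]
  congr 1 with ω
  rw [hjump]
  have : (0 ≤ t - jumpTime H n ω ∧ t - jumpTime H n ω < H n ω) ↔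
      (jumpTime H n ω ≤ t ∧ t < jumpTime H n ω + H n ω) := by
    constructor <;> rintro ⟨h1, h2⟩ <;> constructor <;> linarith
  simp only [this, mul_ite, mul_one, mul_zero]

end Step

/-! ### Linear equations in integrated form: change of decay rate and limits. -/

/-- The resolvent identity for decay kernels. -/
lemma integral_decay_mul_decay (κ κ' t u : ℝ) :
    (κ' - κ) * ∫ s, decay κ (s - u) * decay κ' (t - s) = decay κ (t - u) - decay κ' (t - u) := by
  rcases lt_or_ge t u with htu | htu
  · have h0 : ∀ s, decay κ (s - u) * decay κ' (t - s) = 0 := fun s => by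
      rcases lt_or_ge s u with hs | hs
      · rw [decay_of_neg (by linarith), zero_mul]
      · rw [decay_of_neg (κ := κ') (by linarith), mul_zero]
    simp only [h0, integral_zero, mul_zero]
    rw [decay_of_neg (by linarith), decay_of_neg (by linarith), sub_zero]
  · have h1 : (fun s => decay κ (s - u) * decay κ' (t - s)) = Set.indicator (Set.Icc u t)
        (fun s => Real.exp (-(κ * (s - u)) + -(κ' * (t - s)))) := by
      ext s
      by_cases hs : s ∈ Set.Icc u t
      · rw [Set.indicator_of_mem hs, decay_of_nonneg (by linarith [hs.1]),
          decay_of_nonneg (by linarith [hs.2]), Real.exp_add]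
      · rw [Set.indicator_of_notMem hs]
        rcases lt_or_ge s u with hsu | hsu
        · rw [decay_of_neg (by linarith), zero_mul]
        · rw [decay_of_neg (κ := κ') (by
            have : ¬ s ≤ t := fun h => hs ⟨hsu, h⟩
            linarith), mul_zero]
    -- The factor `κ' - κ` is kept inside, so that the integrand is exactly the derivative of the
    -- exponential; the case `κ = κ'` then needs no separate treatment.
    rw [h1, integral_indicator measurableSet_Icc, integral_Icc_eq_integral_Ioc,
      ← intervalIntegral.integral_of_le htu, ← intervalIntegral.integral_const_mul,
      intervalIntegral.integral_eq_sub_of_hasDerivAt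
        (f := fun s => Real.exp (-(κ * (s - u)) + -(κ' * (t - s))))]
    · rw [decay_of_nonneg (by linarith), decay_of_nonneg (by linarith)]
      simp
    · intro s _
      have h2 : HasDerivAt (fun s => -(κ * (s - u)) + -(κ' * (t - s))) (κ' - κ) s := by
        have := (((hasDerivAt_id s).sub_const u).const_mul κ).neg.add
          (((hasDerivAt_id s).const_sub t).const_mul κ').neg
        convert! this using 1
        ring
      rw [mul_comm]
      exact h2.exp
    · exact Continuous.intervalIntegrable (by fun_prop) _ _

/-- `x` is the response at decay rate `κ` to the source `h` and the initial value `x₀`. -/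
def IsResponse (κ x₀ : ℝ) (h x : ℝ → ℝ) : Prop :=
  ∀ t, x t = x₀ * decay κ t + ∫ s, h s * decay κ (t - s)

lemma integrable_mul_decay {κ : ℝ} (hκ : 0 < κ) {h : ℝ → ℝ} (hm : Measurable h) {K : ℝ}
    (hK : ∀ s, |h s| ≤ K) (t : ℝ) : Integrable (fun s => h s * decay κ (t - s)) :=
  (integrable_decay_sub hκ t).bdd_mul hm.aestronglyMeasurable (Filter.Eventually.of_forall hK)

/-- Shifting the decay rate into the source. -/
lemma IsResponse.shift {κ κ' x₀ : ℝ} (hκ : 0 < κ) (hκ' : 0 < κ') {h x : ℝ → ℝ}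
    (hx : IsResponse κ x₀ h x) (hm : Measurable h) {K : ℝ} (hK : ∀ s, |h s| ≤ K)
    (hxm : Measurable x) {L : ℝ} (hL : ∀ s, |x s| ≤ L) :
    IsResponse κ' x₀ (fun s => h s + (κ' - κ) * x s) x := by
  intro t
  have hd : ∀ s, x s * decay κ' (t - s) = x₀ * (decay κ (s - 0) * decay κ' (t - s)) +
      ∫ u, h u * (decay κ (s - u) * decay κ' (t - s)) := fun s => by
    rw [hx s, add_mul, ← integral_mul_const, sub_zero]
    simp only [mul_assoc]
  have hi0 : Integrable (fun s => decay κ (s - 0) * decay κ' (t - s)) :=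
    integrable_mul_decay hκ' (by fun_prop) (fun s => abs_decay_le_one hκ.le _) t
  have hi : Integrable (Function.uncurry fun s u => h u * (decay κ (s - u) * decay κ' (t - s)))
      (volume.prod volume) := by
    -- The inner kernel has the same mass `1 / κ` for every `s`, so the double integral is finite
    -- and Fubini applies to every bounded source.
    have hb : Integrable (fun z : ℝ × ℝ => decay κ' (t - z.1) * decay κ (z.1 - z.2))
        (volume.prod volume) := by
      rw [integrable_prod_iff (Measurable.aestronglyMeasurable (by fun_prop))]
      refine ⟨Filter.Eventually.of_forall fun s => (integrable_decay_sub hκ s).const_mul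
        (decay κ' (t - s)), ?_⟩
      simp only [norm_mul, Real.norm_of_nonneg (decay_nonneg _ _), integral_const_mul]
      have : ∀ s, ∫ u, decay κ (s - u) = 1 / κ := fun s => by
        rw [integral_sub_left_eq_self (decay κ) volume s, integral_decay hκ]
      simp only [this]
      exact (integrable_decay_sub hκ' t).mul_const _
    have h2 := hb.bdd_mul (f := fun z => h z.2) (c := K)
      (Measurable.aestronglyMeasurable (by fun_prop)) (Filter.Eventually.of_forall fun z => hK z.2)
    refine h2.congr (Filter.Eventually.of_forall fun z => ?_)
    simp only [Function.uncurry]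
    ring
  have hint : (κ' - κ) * ∫ s, x s * decay κ' (t - s) =
      x₀ * (decay κ t - decay κ' t) +
        ((∫ s, h s * decay κ (t - s)) - ∫ s, h s * decay κ' (t - s)) := by
    have hi' : Integrable (fun s => ∫ u, h u * (decay κ (s - u) * decay κ' (t - s))) :=
      hi.integral_prod_left
    simp only [hd]
    rw [integral_add (hi0.const_mul _) hi', integral_integral_swap hi,
      integral_const_mul, mul_add, mul_left_comm, integral_decay_mul_decay, sub_zero,
      ← integral_const_mul, ← integral_sub (integrable_mul_decay hκ hm hK t)
        (integrable_mul_decay hκ' hm hK t)]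
    congr 2 with u
    rw [integral_const_mul, mul_left_comm, integral_decay_mul_decay]
    ring
  simp only [add_mul]
  rw [integral_add (integrable_mul_decay hκ' hm hK t)]
  · simp only [mul_assoc]
    rw [integral_const_mul, hint, hx t]
    ring
  · simp only [mul_assoc]
    exact (integrable_mul_decay hκ' hxm hL t).const_mul _

lemma tendsto_decay {κ : ℝ} (hκ : 0 < κ) : Filter.Tendsto (decay κ) Filter.atTop (nhds 0) := by
  have h1 : Filter.Tendsto (fun u : ℝ => Real.exp (-(κ * u))) Filter.atTop (nhds 0) :=
    Real.tendsto_exp_neg_atTop_nhds_zero.comp (Filter.tendsto_id.const_mul_atTop hκ)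
  refine h1.congr' ?_
  filter_upwards [Filter.eventually_ge_atTop 0] with u hu
  rw [decay_of_nonneg hu]

/-- The response to a source that converges converges. -/
lemma IsResponse.tendsto {κ x₀ : ℝ} (hκ : 0 < κ) {h x : ℝ → ℝ} (hx : IsResponse κ x₀ h x)
    (hm : Measurable h) {K : ℝ} (hK : ∀ s, |h s| ≤ K) {l : ℝ}
    (hl : Filter.Tendsto h Filter.atTop (nhds l)) :
    Filter.Tendsto x Filter.atTop (nhds (l / κ)) := by
  have h1 : ∀ t, x t = x₀ * decay κ t + ∫ u, h (t - u) * decay κ u := fun t => by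
    rw [hx t, ← integral_sub_left_eq_self (fun s => h s * decay κ (t - s)) volume t]
    simp only [sub_sub_cancel]
  have h2 : Filter.Tendsto (fun t => ∫ u, h (t - u) * decay κ u) Filter.atTop
      (nhds (∫ u, l * decay κ u)) := by
    refine tendsto_integral_filter_of_dominated_convergence (fun u => K * decay κ u)
      (Filter.Eventually.of_forall fun t => Measurable.aestronglyMeasurable (by fun_prop))
      (Filter.Eventually.of_forall fun t => Filter.Eventually.of_forall fun u => ?_)
      ((integrable_decay hκ).const_mul K) (Filter.Eventually.of_forall fun u => ?_)
    · rw [norm_mul, Real.norm_eq_abs, Real.norm_of_nonneg (decay_nonneg κ u)]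
      exact mul_le_mul_of_nonneg_right (hK _) (decay_nonneg κ u)
    · exact (hl.comp (Filter.tendsto_atTop_add_const_right _ (-u) Filter.tendsto_id)).mul_const _
  have h3 := ((tendsto_decay hκ).const_mul x₀).add h2
  rw [integral_const_mul, integral_decay hκ] at h3
  simp only [mul_zero, zero_add, mul_one_div] at h3
  exact h3.congr fun t => (h1 t).symm

/-! ### Mass conservation and limits for the three equations. -/

section Equilibrium

variable {lam β ν α κ a e f K : ℝ} {O L M : ℝ → ℝ}

/-- The forward equations of the occupation probabilities conserve the total mass. -/
lemma one_le_add_of_isResponse (hlam : 0 < lam) (hα : 0 < α) (hαβ : α = β + ν)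
    (hO : Measurable O) (hL : Measurable L) (hO0 : ∀ t, 0 ≤ O t) (hL0 : ∀ t, 0 ≤ L t)
    (hO1 : ∀ t, O t ≤ 1) (hL1 : ∀ t, L t ≤ 1)
    (hOr : IsResponse lam 1 (fun s => β * L s) O)
    (hLr : IsResponse α 0 (fun s => lam * O s + ν * L s) L) {t : ℝ} (ht : 0 ≤ t) :
    1 ≤ O t + L t := by
  have hOa : ∀ t, |O t| ≤ 1 := fun t => by rw [abs_of_nonneg (hO0 t)]; exact hO1 t
  have hLa : ∀ t, |L t| ≤ 1 := fun t => by rw [abs_of_nonneg (hL0 t)]; exact hL1 t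
  -- With both equations shifted to the common rate `k`, the sources add up to `k (O + L)` because
  -- `α = β + ν`. This is nonnegative, which leaves the initial term `exp(-kt)` as a lower bound;
  -- then `k → 0`.
  have key : ∀ k : ℝ, 0 < k → Real.exp (-(k * t)) ≤ O t + L t := fun k hk => by
    have hb1 : ∀ s, |β * L s| ≤ |β| * 1 := fun s => by
      rw [abs_mul]; exact mul_le_mul_of_nonneg_left (hLa s) (abs_nonneg _)
    have hb2 : ∀ s, |lam * O s + ν * L s| ≤ |lam| * 1 + |ν| * 1 := fun s => by
      refine (abs_add_le _ _).trans ?_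
      rw [abs_mul, abs_mul]
      have := hOa s
      have := hLa s
      gcongr
    have h1 := hOr.shift hlam hk (by fun_prop) hb1 hO hOa t
    have h2 := hLr.shift hα hk (by fun_prop) hb2 hL hLa t
    have hi1 : Integrable (fun s => (β * L s + (k - lam) * O s) * decay k (t - s)) :=
      integrable_mul_decay hk (by fun_prop) (K := |β| * 1 + |k - lam| * 1) (fun s => by
        refine (abs_add_le _ _).trans ?_
        rw [abs_mul, abs_mul]
        have := hOa s
        have := hLa s
        gcongr) t
    have hi2 : Integrable (fun s => (lam * O s + ν * L s + (k - α) * L s) * decay k (t - s)) :=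
      integrable_mul_decay hk (by fun_prop) (K := |lam| * 1 + |ν| * 1 + |k - α| * 1) (fun s => by
        refine (abs_add_le _ _).trans (add_le_add (hb2 s) ?_)
        rw [abs_mul]
        have := hLa s
        gcongr) t
    have h3 : O t + L t = decay k t + ∫ s, k * (O s + L s) * decay k (t - s) := by
      rw [h1, h2, zero_mul, zero_add, one_mul, add_assoc, ← integral_add hi1 hi2]
      congr 2 with s
      rw [hαβ]
      ring
    rw [h3, decay_of_nonneg ht]
    refine le_add_of_nonneg_right (integral_nonneg fun s => ?_)
    exact mul_nonneg (mul_nonneg hk.le (add_nonneg (hO0 s) (hL0 s))) (decay_nonneg _ _)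
  have hlim : Filter.Tendsto (fun k : ℝ => Real.exp (-(k * t))) (nhdsWithin 0 (Set.Ioi 0))
      (nhds 1) := by
    have : Continuous fun k : ℝ => Real.exp (-(k * t)) := by fun_prop
    have h0 := this.tendsto 0
    simp only [zero_mul, neg_zero, Real.exp_zero] at h0
    exact h0.mono_left nhdsWithin_le_nhds
  exact le_of_tendsto hlim (Filter.eventually_of_mem self_mem_nhdsWithin fun k hk => key k hk)

/-- At decay rate `lam + β` the source of `L` is `lam * (O + L)`, which is the constant `lam` for
nonnegative times. -/
lemma tendsto_occupation (hlam : 0 < lam) (hα : 0 < α) (hβ : 0 < β) (hαβ : α = β + ν)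
    (hO : Measurable O) (hL : Measurable L) (hOa : ∀ t, |O t| ≤ 1) (hLa : ∀ t, |L t| ≤ 1)
    (hOL : ∀ t, 0 ≤ t → O t + L t = 1)
    (hLr : IsResponse α 0 (fun s => lam * O s + ν * L s) L) :
    Filter.Tendsto L Filter.atTop (nhds (lam / (lam + β))) := by
  have hb2 : ∀ s, |lam * O s + ν * L s| ≤ |lam| * 1 + |ν| * 1 := fun s => by
    refine (abs_add_le _ _).trans ?_
    rw [abs_mul, abs_mul]
    have := hOa s
    have := hLa s
    gcongr
  have h := hLr.shift hα (add_pos hlam hβ) (by fun_prop) hb2 hL hLa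
  refine h.tendsto (add_pos hlam hβ) (by fun_prop) (K := |lam| * 1 + |ν| * 1 + |lam + β - α| * 1)
    (fun s => ?_) ?_
  · refine (abs_add_le _ _).trans (add_le_add (hb2 s) ?_)
    rw [abs_mul]
    have := hLa s
    gcongr
  · refine tendsto_const_nhds.congr' ?_
    filter_upwards [Filter.eventually_ge_atTop 0] with s hs
    rw [hαβ, eq_sub_of_add_eq (hOL s hs)]
    ring

/-- At decay rate `κ - ν * a` the feedback term `ν * a * M` cancels from the source. What remains
involves only `O` and `L`, whose limits are given. -/
lemma tendsto_mean (hκ : 0 < κ) (hκ' : 0 < κ - ν * a)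
    (hO : Measurable O) (hL : Measurable L) (hM : Measurable M)
    (hOa : ∀ t, |O t| ≤ 1) (hLa : ∀ t, |L t| ≤ 1) (hMa : ∀ t, |M t| ≤ K) {o l : ℝ}
    (hOl : Filter.Tendsto O Filter.atTop (nhds o)) (hLl : Filter.Tendsto L Filter.atTop (nhds l))
    (hMr : IsResponse κ 0 (fun s => lam * f * O s + ν * (a * M s + e * L s)) M) :
    Filter.Tendsto M Filter.atTop (nhds ((lam * f * o + ν * e * l) / (κ - ν * a))) := by
  have hb : ∀ s, |lam * f * O s + ν * (a * M s + e * L s)| ≤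
      |lam * f| * 1 + |ν| * (|a| * K + |e| * 1) := fun s => by
    have := hOa s
    have := hLa s
    have := hMa s
    refine (abs_add_le _ _).trans ?_
    rw [abs_mul (lam * f), abs_mul ν]
    gcongr
    refine (abs_add_le _ _).trans ?_
    rw [abs_mul, abs_mul]
    gcongr
  have h := hMr.shift hκ hκ' (by fun_prop) hb hM hMa
  have h' : (fun s => lam * f * O s + ν * (a * M s + e * L s) + (κ - ν * a - κ) * M s) =
      fun s => lam * f * O s + ν * e * L s := by
    ext s
    ring
  rw [h'] at h
  refine h.tendsto hκ' (by fun_prop) (K := |lam * f| * 1 + |ν * e| * 1) (fun s => ?_)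
    ((hOl.const_mul _).add (hLl.const_mul _))
  refine (abs_add_le _ _).trans ?_
  rw [abs_mul, abs_mul (ν * e)]
  have := hOa s
  have := hLa s
  gcongr

end Equilibrium

/-! ### Exit rates and jump probabilities of the 1G1B system. -/

section Rates

variable {lam mu q p : ℝ}

lemma exitRate_none : exitRate (bufferRate lam mu q p) none = lam := by
  rw [exitRate, tsum_eq_single (some 0)]
  · simp [bufferRate]
  · rintro (_ | j) hj
    · rfl
    · have : j ≠ 0 := fun h => hj (by rw [h])
      simp [bufferRate, this]

lemma exitRate_some (i : ℕ) : exitRate (bufferRate lam mu q p) (some i) = mu + lam * q := by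
  rw [exitRate, tsum_eq_sum (s := {none, some (i + 1)})]
  · rw [Finset.sum_pair (by simp)]
    simp [bufferRate]
    ring
  · rintro (_ | j) hj
    · simp at hj
    · have : j ≠ i + 1 := fun h => hj (by simp [h])
      simp [bufferRate, this]

lemma exitRate_of_mem_compl {x : Option ℕ} (hx : x ∈ ({none}ᶜ : Set (Option ℕ))) :
    exitRate (bufferRate lam mu q p) x = mu + lam * q := by
  obtain ⟨i, rfl⟩ := Option.ne_none_iff_exists'.1 hx
  exact exitRate_some i

lemma exitRate_pos (hlam : 0 < lam) (hα : 0 < mu + lam * q) (x : Option ℕ) :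
    0 < exitRate (bufferRate lam mu q p) x := by
  rcases x with _ | i
  · rwa [exitRate_none]
  · rwa [exitRate_some]

lemma jumpProb_none_none : jumpProb (bufferRate lam mu q p) none none = 0 := by
  simp [jumpProb, bufferRate]

lemma jumpProb_none_some (hlam : 0 < lam) (j : ℕ) :
    jumpProb (bufferRate lam mu q p) none (some j) = if j = 0 then 1 else 0 := by
  rw [jumpProb, exitRate_none]
  simp only [bufferRate]
  split_ifs
  exacts [div_self hlam.ne', zero_div _]

lemma jumpProb_some_none (i : ℕ) : jumpProb (bufferRate lam mu q p) (some i) none =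
    (mu + lam * q * (1 - p)) / (mu + lam * q) := by
  rw [jumpProb, exitRate_some]
  rfl

lemma jumpProb_some_some (i j : ℕ) : jumpProb (bufferRate lam mu q p) (some i) (some j) =
    if j = i + 1 then lam * q * p / (mu + lam * q) else 0 := by
  rw [jumpProb, exitRate_some]
  simp only [bufferRate]
  split_ifs
  exacts [rfl, zero_div _]

lemma tsum_compl_none (g : Option ℕ → ENNReal) :
    ∑' x : ({none}ᶜ : Set (Option ℕ)), g x = ∑' i : ℕ, g (some i) := by
  have h : ({none}ᶜ : Set (Option ℕ)) = Set.range some := by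
    ext x
    cases x <;> simp
  rw [h, tsum_range _ (Option.some_injective ℕ)]

lemma tsum_jumpProb_none_to_none {x : Option ℕ} (hx : x ∈ ({none} : Set (Option ℕ))) :
    ∑' x' : ({none} : Set (Option ℕ)), ENNReal.ofReal (jumpProb (bufferRate lam mu q p) x x') =
      ENNReal.ofReal 0 := by
  rw [Set.mem_singleton_iff.1 hx,
    tsum_singleton none (fun x' => ENNReal.ofReal (jumpProb (bufferRate lam mu q p) none x')),
    jumpProb_none_none]

lemma tsum_jumpProb_none_to_link (hlam : 0 < lam) {x : Option ℕ}
    (hx : x ∈ ({none} : Set (Option ℕ))) :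
    ∑' x' : ({none}ᶜ : Set (Option ℕ)), ENNReal.ofReal (jumpProb (bufferRate lam mu q p) x x') =
      ENNReal.ofReal 1 := by
  rw [Set.mem_singleton_iff.1 hx,
    tsum_compl_none (fun x' => ENNReal.ofReal (jumpProb (bufferRate lam mu q p) none x')),
    tsum_eq_single 0]
  · simp [jumpProb_none_some hlam]
  · intro j hj
    simp [jumpProb_none_some hlam, hj]

lemma tsum_jumpProb_link_to_none {x : Option ℕ} (hx : x ∈ ({none}ᶜ : Set (Option ℕ))) :
    ∑' x' : ({none} : Set (Option ℕ)), ENNReal.ofReal (jumpProb (bufferRate lam mu q p) x x') =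
      ENNReal.ofReal ((mu + lam * q * (1 - p)) / (mu + lam * q)) := by
  obtain ⟨i, rfl⟩ := Option.ne_none_iff_exists'.1 hx
  rw [tsum_singleton none
    (fun x' => ENNReal.ofReal (jumpProb (bufferRate lam mu q p) (some i) x')), jumpProb_some_none]

lemma tsum_jumpProb_link_to_link {x : Option ℕ} (hx : x ∈ ({none}ᶜ : Set (Option ℕ))) :
    ∑' x' : ({none}ᶜ : Set (Option ℕ)), ENNReal.ofReal (jumpProb (bufferRate lam mu q p) x x') =
      ENNReal.ofReal (lam * q * p / (mu + lam * q)) := by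
  obtain ⟨i, rfl⟩ := Option.ne_none_iff_exists'.1 hx
  rw [tsum_compl_none (fun x' => ENNReal.ofReal (jumpProb (bufferRate lam mu q p) (some i) x')),
    tsum_eq_single (i + 1)]
  · simp [jumpProb_some_some]
  · intro j hj
    simp [jumpProb_some_some, hj]

lemma tsum_jumpProb (hlam : 0 < lam) (hα : 0 < mu + lam * q) (hβ : 0 ≤ mu + lam * q * (1 - p))
    (hν : 0 ≤ lam * q * p) (x : Option ℕ) :
    ∑' x', ENNReal.ofReal (jumpProb (bufferRate lam mu q p) x x') = 1 := by
  rw [← ENNReal.summable.tsum_add_tsum_compl (s := {none}) ENNReal.summable]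
  by_cases hx : x = none
  · rw [tsum_jumpProb_none_to_none hx, tsum_jumpProb_none_to_link hlam hx]
    simp
  · rw [tsum_jumpProb_link_to_none hx, tsum_jumpProb_link_to_link hx,
      ← ENNReal.ofReal_add (by positivity) (by positivity), ← add_div, ENNReal.ofReal_eq_one,
      div_eq_one_iff_eq hα.ne']
    ring

end Rates

/-! ### The fidelity at jump times and the recursion over the number of jumps. -/

section Recursion

variable {Ω : Type*} [MeasurableSpace Ω] {P : Measure Ω} {Y : ℕ → Ω → Option ℕ} {H : ℕ → Ω → ℝ}

/-- The fidelity of the link just after the `n`-th jump, provided that there is a link then. -/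
def entryFidelity (Γ a b F₀ : ℝ) (Y : ℕ → Ω → Option ℕ) (H : ℕ → Ω → ℝ) : ℕ → Ω → ℝ
  | 0, _ => F₀
  | n + 1, ω =>
      if Y n ω = none then F₀ else a * depol Γ |H n ω| (entryFidelity Γ a b F₀ Y H n ω) + b

/-- An affine map of `[0, 1]` into itself moves the midpoint `1/2` by at most `(1 - |a|) / 2`, so it
preserves every ball around `1/2` of radius `R ≥ 1/2`. Such balls give a uniform bound on the
fidelity without having to place the fidelity of the new link in `[0, 1]`. -/
lemma abs_affine_sub_half_le {a b R x : ℝ} (hJ : ∀ F ∈ Set.Icc (0 : ℝ) 1, a * F + b ∈ Set.Icc 0 1)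
    (hR : 1 / 2 ≤ R) (hx : |x - 1 / 2| ≤ R) : |a * x + b - 1 / 2| ≤ R := by
  have h0 := hJ 0 (by simp)
  have h1 := hJ 1 (by simp)
  simp only [mul_zero, zero_add, mul_one, Set.mem_Icc] at h0 h1
  rw [abs_le] at hx ⊢
  rcases le_total 0 a with ha | ha <;> constructor <;> nlinarith

/-- Depolarisation is a convex combination with `1/4`, and `1/4` lies in the ball. -/
lemma abs_depol_sub_half_le {Γ t R x : ℝ} (hΓ : 0 ≤ Γ) (ht : 0 ≤ t) (hR : 1 / 2 ≤ R)
    (hx : |x - 1 / 2| ≤ R) : |depol Γ t x - 1 / 2| ≤ R := by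
  have h1 : Real.exp (-Γ * t) ≤ 1 := Real.exp_le_one_iff.2 (by nlinarith)
  have h0 := Real.exp_pos (-Γ * t)
  rw [abs_le] at hx ⊢
  unfold depol
  constructor <;> nlinarith

omit [MeasurableSpace Ω] in
lemma abs_entryFidelity_sub_half_le {Γ a b F₀ : ℝ} (hΓ : 0 ≤ Γ)
    (hJ : ∀ F ∈ Set.Icc (0 : ℝ) 1, a * F + b ∈ Set.Icc 0 1) (n : ℕ) (ω : Ω) :
    |entryFidelity Γ a b F₀ Y H n ω - 1 / 2| ≤ max (1 / 2) |F₀ - 1 / 2| := by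
  induction n with
  | zero => exact le_max_right _ _
  | succ n ih =>
    rw [entryFidelity]
    split_ifs
    · exact le_max_right _ _
    · exact abs_affine_sub_half_le hJ (le_max_left _ _)
        (abs_depol_sub_half_le hΓ (abs_nonneg _) (le_max_left _ _) ih)

omit [MeasurableSpace Ω] in
lemma abs_entryFidelity_sub_quarter_le {Γ a b F₀ : ℝ} (hΓ : 0 ≤ Γ)
    (hJ : ∀ F ∈ Set.Icc (0 : ℝ) 1, a * F + b ∈ Set.Icc 0 1) (n : ℕ) (ω : Ω) :
    |entryFidelity Γ a b F₀ Y H n ω - 1 / 4| ≤ max (1 / 2) |F₀ - 1 / 2| + 1 / 4 := by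
  have h := abs_entryFidelity_sub_half_le (Y := Y) (H := H) (F₀ := F₀) hΓ hJ n ω
  rw [abs_le] at h ⊢
  constructor <;> linarith

omit [MeasurableSpace Ω] in
lemma measurable_hist_entryFidelity (Γ a b F₀ : ℝ) (Y : ℕ → Ω → Option ℕ) (H : ℕ → Ω → ℝ)
    (n : ℕ) : Measurable[hist Y H n] (entryFidelity Γ a b F₀ Y H n) := by
  induction n with
  | zero => exact @measurable_const _ _ _ (hist Y H 0) F₀
  | succ n ih =>
    have ih' : Measurable[hist Y H (n + 1)] (entryFidelity Γ a b F₀ Y H n) :=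
      ih.mono (hist_mono Y H n) le_rfl
    have hH : Measurable[hist Y H (n + 1)] (H n) := measurable_hist_H Y H (Nat.lt_succ_self n)
    have hY : MeasurableSet[hist Y H (n + 1)] {ω | Y n ω = none} :=
      measurableSet_hist_Y Y H (Nat.le_succ n) {none}
    let _ := hist Y H (n + 1)
    have h : Measurable (fun ω => a * depol Γ |H n ω| (entryFidelity Γ a b F₀ Y H n ω) + b) := by
      unfold depol
      fun_prop
    exact Measurable.ite hY measurable_const h

/-- The occupation kernel of the empty state after `n` jumps. -/
def emptyMean (P : Measure Ω) (lam : ℝ) (Y : ℕ → Ω → Option ℕ) (H : ℕ → Ω → ℝ) (n : ℕ)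
    (t : ℝ) : ℝ :=
  decayMean P Y H n {none} (fun _ => 1) lam t

/-- The occupation kernel of the states with a link after `n` jumps. -/
def linkMean (P : Measure Ω) (α : ℝ) (Y : ℕ → Ω → Option ℕ) (H : ℕ → Ω → ℝ) (n : ℕ)
    (t : ℝ) : ℝ :=
  decayMean P Y H n {none}ᶜ (fun _ => 1) α t

/-- The mean excess of the fidelity over `1 / 4` in the states with a link after `n` jumps. -/
def excessMean (P : Measure Ω) (α Γ a b F₀ : ℝ) (Y : ℕ → Ω → Option ℕ) (H : ℕ → Ω → ℝ) (n : ℕ)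
    (t : ℝ) : ℝ :=
  decayMean P Y H n {none}ᶜ (fun ω => entryFidelity Γ a b F₀ Y H n ω - 1 / 4) (α + Γ) t

variable {R : Option ℕ → Option ℕ → ℝ} {x₀ : Option ℕ} {lam mu q p : ℝ}

lemma IsCTMC.integrable_mul_decay_jumpTime [IsFiniteMeasure P] (hC : IsCTMC R x₀ P Y H) (n : ℕ)
    {W : Ω → ℝ} (hW : Measurable W) {K : ℝ} (hK : ∀ ω, |W ω| ≤ K) {κ : ℝ} (hκ : 0 ≤ κ) (t : ℝ) :
    Integrable (fun ω => W ω * decay κ (t - jumpTime H n ω)) P := by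
  have := hC.measurable_jumpTime n
  refine Integrable.of_bound (C := |K| * 1) (Measurable.aestronglyMeasurable (by fun_prop))
    (Filter.Eventually.of_forall fun ω => ?_)
  rw [norm_mul, Real.norm_eq_abs, Real.norm_eq_abs]
  exact mul_le_mul ((hK ω).trans (le_abs_self K)) (abs_decay_le_one hκ _) (abs_nonneg _)
    (abs_nonneg _)

lemma IsCTMC.decayMean_succ [IsFiniteMeasure P] (hC : IsCTMC R x₀ P Y H) (n : ℕ)
    (C' : Set (Option ℕ)) {W : Ω → ℝ} (hW : Measurable W) {K : ℝ} (hK : ∀ ω, |W ω| ≤ K) {κ : ℝ}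
    (hκ : 0 ≤ κ) (t : ℝ) :
    decayMean P Y H (n + 1) C' W κ t =
      (∫ ω in {ω | Y n ω ∈ ({none} : Set (Option ℕ))} ∩ {ω | Y (n + 1) ω ∈ C'},
        W ω * decay κ (t - jumpTime H (n + 1) ω) ∂P) +
      ∫ ω in {ω | Y n ω ∈ ({none}ᶜ : Set (Option ℕ))} ∩ {ω | Y (n + 1) ω ∈ C'},
        W ω * decay κ (t - jumpTime H (n + 1) ω) ∂P := by
  have hi := hC.integrable_mul_decay_jumpTime (n + 1) hW hK hκ t
  rw [decayMean, ← setIntegral_union]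
  · congr 2
    ext ω
    simp only [Set.mem_ofPred_eq, Set.mem_union, Set.mem_inter_iff, Set.mem_compl_iff]
    tauto
  · exact Set.disjoint_left.2 fun ω h h' => h'.1 h.1
  · exact (hC.measurableSet_mem n _).inter (hC.measurableSet_mem (n + 1) _)
  · exact hi.integrableOn
  · exact hi.integrableOn

variable [IsProbabilityMeasure P]

/-- The empty state is entered only from a link; the exit rate `α` times the jump probability `β /
α` gives the coefficient `β`. -/
lemma emptyMean_succ (hsys : Is1G1B lam mu q p P Y H) (hlam : 0 < lam) (hα : 0 < mu + lam * q)
    (hβ : 0 ≤ mu + lam * q * (1 - p)) (n : ℕ) (t : ℝ) :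
    emptyMean P lam Y H (n + 1) t =
      (mu + lam * q * (1 - p)) * ∫ s, linkMean P (mu + lam * q) Y H n s * decay lam (t - s) := by
  have hR := exitRate_pos (p := p) hlam hα
  have hm : Measurable[hist Y H n] (fun _ : Ω => (1 : ℝ)) :=
    @measurable_const _ _ _ (hist Y H n) 1
  have h1 := IsCTMC.setIntegral_step hsys hR n hlam le_rfl
    (fun x hx => by rw [Set.mem_singleton_iff.1 hx]; exact exitRate_none)
    (fun x hx => tsum_jumpProb_none_to_none hx) hm (K := 1) (fun _ => by simp) le_rfl hlam t
  have h2 := IsCTMC.setIntegral_step hsys hR n hα (div_nonneg hβ hα.le)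
    (fun x hx => exitRate_of_mem_compl hx)
    (fun x hx => tsum_jumpProb_link_to_none hx) hm (K := 1) (fun _ => by simp) le_rfl hlam t
  simp only [zero_mul, neg_zero, Real.exp_zero, one_mul, add_zero] at h1 h2
  rw [emptyMean, IsCTMC.decayMean_succ hsys n _ measurable_const (K := 1) (fun _ => by simp)
    hlam.le]
  simp only [one_mul]
  rw [h1, h2, zero_add, div_mul_cancel₀ _ hα.ne']
  rfl

lemma linkMean_succ (hsys : Is1G1B lam mu q p P Y H) (hlam : 0 < lam) (hα : 0 < mu + lam * q)
    (hν : 0 ≤ lam * q * p) (n : ℕ) (t : ℝ) :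
    linkMean P (mu + lam * q) Y H (n + 1) t =
      lam * (∫ s, emptyMean P lam Y H n s * decay (mu + lam * q) (t - s)) +
      lam * q * p *
        ∫ s, linkMean P (mu + lam * q) Y H n s * decay (mu + lam * q) (t - s) := by
  have hR := exitRate_pos (p := p) hlam hα
  have hm : Measurable[hist Y H n] (fun _ : Ω => (1 : ℝ)) :=
    @measurable_const _ _ _ (hist Y H n) 1
  have h1 := IsCTMC.setIntegral_step hsys hR n hlam zero_le_one
    (fun x hx => by rw [Set.mem_singleton_iff.1 hx]; exact exitRate_none)
    (fun x hx => tsum_jumpProb_none_to_link hlam hx) hm (K := 1) (fun _ => by simp) le_rfl hα t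
  have h2 := IsCTMC.setIntegral_step hsys hR n hα (div_nonneg hν hα.le)
    (fun x hx => exitRate_of_mem_compl hx)
    (fun x hx => tsum_jumpProb_link_to_link hx) hm (K := 1) (fun _ => by simp) le_rfl hα t
  simp only [zero_mul, neg_zero, Real.exp_zero, one_mul, add_zero] at h1 h2
  rw [linkMean, IsCTMC.decayMean_succ hsys n _ measurable_const (K := 1) (fun _ => by simp)
    hα.le]
  simp only [one_mul]
  rw [h1, h2, div_mul_cancel₀ _ hα.ne']
  rfl

/-- A link entered from the empty state starts with excess `F₀ - 1 / 4`. A pumped link starts with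
`a` times the old excess, discounted by `exp(-Γh)` over the holding time `h`, plus the constant `a /
4 + b - 1 / 4`. The discount raises the decay rate of the old term to `α + Γ`, so `excessMean`
reappears on the right. -/
lemma excessMean_succ (hsys : Is1G1B lam mu q p P Y H) (hlam : 0 < lam) (hα : 0 < mu + lam * q)
    (hν : 0 ≤ lam * q * p) {Γ a b F₀ : ℝ} (hΓ : 0 ≤ Γ)
    (hJ : ∀ F ∈ Set.Icc (0 : ℝ) 1, a * F + b ∈ Set.Icc 0 1) (n : ℕ) (t : ℝ) :
    excessMean P (mu + lam * q) Γ a b F₀ Y H (n + 1) t =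
      lam * (F₀ - 1 / 4) * (∫ s, emptyMean P lam Y H n s * decay (mu + lam * q + Γ) (t - s)) +
      lam * q * p *
        (a * (∫ s, excessMean P (mu + lam * q) Γ a b F₀ Y H n s *
            decay (mu + lam * q + Γ) (t - s)) +
          (a / 4 + b - 1 / 4) *
            ∫ s, linkMean P (mu + lam * q) Y H n s * decay (mu + lam * q + Γ) (t - s)) := by
  have hR := exitRate_pos (p := p) hlam hα
  have hκ : 0 < mu + lam * q + Γ := by linarith
  have hm : Measurable[hist Y H n] (fun _ : Ω => (1 : ℝ)) :=
    @measurable_const _ _ _ (hist Y H n) 1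
  have hG := measurable_hist_entryFidelity Γ a b F₀ Y H n
  have hGm : Measurable[hist Y H n] (fun ω => entryFidelity Γ a b F₀ Y H n ω - 1 / 4) :=
    hG.sub_const _
  have hG1 : Measurable (entryFidelity Γ a b F₀ Y H (n + 1)) :=
    (measurable_hist_entryFidelity Γ a b F₀ Y H (n + 1)).mono (IsCTMC.hist_le hsys _) le_rfl
  have hGb := abs_entryFidelity_sub_quarter_le (Y := Y) (H := H) (F₀ := F₀) hΓ hJ
  have h1 := IsCTMC.setIntegral_step hsys hR n hlam zero_le_one
    (fun x hx => by rw [Set.mem_singleton_iff.1 hx]; exact exitRate_none)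
    (fun x hx => tsum_jumpProb_none_to_link hlam hx) hm (K := 1) (fun _ => by simp) le_rfl hκ t
  have h2 := IsCTMC.setIntegral_step hsys hR n hα (div_nonneg hν hα.le)
    (fun x hx => exitRate_of_mem_compl hx)
    (fun x hx => tsum_jumpProb_link_to_link hx) hm (K := 1) (fun _ => by simp) le_rfl hκ t
  have h3 := IsCTMC.setIntegral_step hsys hR n hα (div_nonneg hν hα.le)
    (fun x hx => exitRate_of_mem_compl hx)
    (fun x hx => tsum_jumpProb_link_to_link hx) hGm (hGb n) hΓ hκ t
  simp only [zero_mul, neg_zero, Real.exp_zero, one_mul, add_zero] at h1 h2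
  rw [div_mul_cancel₀ _ hα.ne'] at h2 h3
  rw [excessMean, IsCTMC.decayMean_succ hsys n _ (hG1.sub_const _) (hGb (n + 1)) hκ.le]
  have hms : ∀ C C' : Set (Option ℕ), MeasurableSet ({ω | Y n ω ∈ C} ∩ {ω | Y (n + 1) ω ∈ C'}) :=
    fun C C' => (IsCTMC.measurableSet_mem hsys n _).inter (IsCTMC.measurableSet_mem hsys _ _)
  have e1 : ∫ ω in {ω | Y n ω ∈ ({none} : Set (Option ℕ))} ∩
        {ω | Y (n + 1) ω ∈ ({none}ᶜ : Set (Option ℕ))},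
        (entryFidelity Γ a b F₀ Y H (n + 1) ω - 1 / 4) *
          decay (mu + lam * q + Γ) (t - jumpTime H (n + 1) ω) ∂P =
      lam * (F₀ - 1 / 4) * ∫ s, emptyMean P lam Y H n s * decay (mu + lam * q + Γ) (t - s) := by
    rw [mul_comm lam (F₀ - 1 / 4), mul_assoc (F₀ - 1 / 4)]
    have : lam * ∫ s, emptyMean P lam Y H n s * decay (mu + lam * q + Γ) (t - s) = _ := h1.symm
    rw [this, ← integral_const_mul]
    refine setIntegral_congr_fun (hms _ _) fun ω hω => ?_
    have : Y n ω = none := hω.1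
    simp [entryFidelity, this]
  have e2 : ∫ ω in {ω | Y n ω ∈ ({none}ᶜ : Set (Option ℕ))} ∩
        {ω | Y (n + 1) ω ∈ ({none}ᶜ : Set (Option ℕ))},
        (entryFidelity Γ a b F₀ Y H (n + 1) ω - 1 / 4) *
          decay (mu + lam * q + Γ) (t - jumpTime H (n + 1) ω) ∂P =
      lam * q * p *
        (a * (∫ s, excessMean P (mu + lam * q) Γ a b F₀ Y H n s *
            decay (mu + lam * q + Γ) (t - s)) +
          (a / 4 + b - 1 / 4) *
            ∫ s, linkMean P (mu + lam * q) Y H n s * decay (mu + lam * q + Γ) (t - s)) := by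
    rw [mul_add, mul_left_comm, mul_left_comm _ (a / 4 + b - 1 / 4)]
    have l2 : lam * q * p * ∫ s, linkMean P (mu + lam * q) Y H n s *
      decay (mu + lam * q + Γ) (t - s) = _ := h2.symm
    have l3 : lam * q * p * ∫ s, excessMean P (mu + lam * q) Γ a b F₀ Y H n s *
      decay (mu + lam * q + Γ) (t - s) = _ := h3.symm
    have hHm := IsCTMC.measurable_H hsys n
    have hTm := IsCTMC.measurable_jumpTime hsys (n + 1)
    have hGn : Measurable (entryFidelity Γ a b F₀ Y H n) := hG.mono (IsCTMC.hist_le hsys _) le_rfl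
    have i2 := IsCTMC.integrable_mul_decay_jumpTime hsys (n + 1) (W := fun _ => 1)
      measurable_const (K := 1) (fun _ => by simp) hκ.le t
    have i3 := IsCTMC.integrable_mul_decay_jumpTime hsys (n + 1)
      (W := fun ω => (entryFidelity Γ a b F₀ Y H n ω - 1 / 4) * Real.exp (-(Γ * |H n ω|)))
      (by fun_prop) (K := (max (1 / 2) |F₀ - 1 / 2| + 1 / 4) * 1) (fun ω => by
        rw [abs_mul, Real.abs_exp]
        exact mul_le_mul (hGb n ω) (Real.exp_le_one_iff.2 (neg_nonpos.2 (by positivity)))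
          (Real.exp_pos _).le ((abs_nonneg _).trans (hGb n ω))) hκ.le t
    simp only [one_mul] at i2
    rw [l2, l3, ← integral_const_mul, ← integral_const_mul,
      ← integral_add (i3.integrableOn.const_mul _) (i2.integrableOn.const_mul _)]
    refine setIntegral_congr_fun (hms _ _) fun ω hω => ?_
    have : Y n ω ≠ none := hω.1
    simp only [entryFidelity, this, if_false, depol, neg_mul]
    ring
  rw [e1, e2]

end Recursion

/-! ### Summation over the number of jumps. -/

section Series

variable {f : ℕ → ℝ → ℝ}

lemma measurable_tsum_of_summable {E : Type*} [MeasurableSpace E] {f : ℕ → E → ℝ}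
    (hf : ∀ n, Measurable (f n)) (hs : ∀ s, Summable fun n => f n s) :
    Measurable fun s => ∑' n, f n s :=
  measurable_of_tendsto_metrizable
    (f := fun N s => ∑ n ∈ Finset.range N, f n s)
    (fun _ => Finset.measurable_fun_sum _ fun n _ => hf n)
    (tendsto_pi_nhds.2 fun s => (hs s).hasSum.tendsto_sum_nat)

lemma abs_tsum_le_of_summable_abs {f : ℕ → ℝ} (hs : Summable fun n => |f n|) {B : ℝ}
    (hB : ∑' n, |f n| ≤ B) : |∑' n, f n| ≤ B :=
  (norm_tsum_le_tsum_norm (f := f) hs).trans hB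

/-- Dominated convergence: the sum of the absolute values is bounded by `B` uniformly in `s`, and
the kernel is integrable. -/
lemma hasSum_integral_mul_decay (hf : ∀ n, Measurable (f n)) (hs : ∀ s, Summable fun n => |f n s|)
    {B : ℝ} (hB : ∀ s, ∑' n, |f n s| ≤ B) {κ : ℝ} (hκ : 0 < κ) (t : ℝ) :
    HasSum (fun n => ∫ s, f n s * decay κ (t - s)) (∫ s, (∑' n, f n s) * decay κ (t - s)) := by
  have hsum : ∀ s, HasSum (fun n => f n s * decay κ (t - s)) ((∑' n, f n s) * decay κ (t - s)) :=
    fun s => (Summable.of_abs (hs s)).hasSum.mul_right _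
  refine hasSum_integral_of_dominated_convergence (fun n s => |f n s| * decay κ (t - s))
    (fun n => Measurable.aestronglyMeasurable (by have := hf n; fun_prop))
    (fun n => Filter.Eventually.of_forall fun s => ?_)
    (Filter.Eventually.of_forall fun s => (hs s).mul_right _) ?_
    (Filter.Eventually.of_forall hsum)
  · rw [norm_mul, Real.norm_eq_abs, Real.norm_of_nonneg (decay_nonneg _ _)]
  · simp only [tsum_mul_right]
    refine integrable_mul_decay hκ (measurable_tsum_of_summable (fun n => (hf n).abs) hs) (K := B)
      (fun s => ?_) t
    rw [abs_of_nonneg (tsum_nonneg fun n => abs_nonneg _)]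
    exact hB s

end Series

/-! ### Almost sure properties of the jump chain and the holding times. -/

section AlmostSure

variable {S : Type*} [DecidableEq S] [Countable S] {Ω : Type*} [MeasurableSpace Ω]
  {R : S → S → ℝ} {x₀ : S} {P : Measure Ω} {Y : ℕ → Ω → S} {H : ℕ → Ω → ℝ}

lemma IsCTMC.ae_nonneg [IsFiniteMeasure P] (hC : IsCTMC R x₀ P Y H)
    (hR : ∀ x, 0 < exitRate R x) : ∀ᵐ ω ∂P, ∀ n, 0 ≤ H n ω := by
  rw [ae_all_iff]
  intro n
  have h : ∀ x, P ({ω | Y n ω = x} ∩ {ω | H n ω ∈ Set.Iio 0}) = 0 := fun x => by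
    have := hC.measure_inter hR n (C := {x}) (C' := Set.univ) (r := exitRate R x)
      (c := ∑' x' : (Set.univ : Set S), ENNReal.ofReal (jumpProb R x x'))
      (fun y hy => by rw [Set.mem_singleton_iff.1 hy])
      (fun y hy => by rw [Set.mem_singleton_iff.1 hy]) (measurableSet_Iio (a := (0 : ℝ)))
      (@MeasurableSet.univ _ (hist Y H n))
    rw [expMeasure_Iio, zero_mul, mul_zero] at this
    refine measure_mono_null (fun ω hω => ?_) this
    exact ⟨trivial, hω, trivial⟩
  refine measure_mono_null (fun ω hω => ?_) (measure_iUnion_null h)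
  simp only [Set.mem_compl_iff, Set.mem_ofPred_eq, not_le] at hω
  exact Set.mem_iUnion.2 ⟨Y n ω, rfl, hω⟩

/-- There are countably many pairs of states, so the null events of making a forbidden jump can be
collected. -/
lemma IsCTMC.ae_jumpProb_pos [IsFiniteMeasure P] (hC : IsCTMC R x₀ P Y H)
    (hR : ∀ x, 0 < exitRate R x) : ∀ᵐ ω ∂P, ∀ n, 0 < jumpProb R (Y n ω) (Y (n + 1) ω) := by
  rw [ae_all_iff]
  intro n
  have h : ∀ x x', jumpProb R x x' ≤ 0 →
      P ({ω | Y n ω = x} ∩ {ω | Y (n + 1) ω = x'}) = 0 := fun x x' hx => by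
    have := hC.measure_inter hR n (C := {x}) (C' := {x'}) (r := exitRate R x)
      (c := ENNReal.ofReal (jumpProb R x x'))
      (fun y hy => by rw [Set.mem_singleton_iff.1 hy])
      (fun y hy => by
        rw [Set.mem_singleton_iff.1 hy,
          tsum_singleton x' (fun x' => ENNReal.ofReal (jumpProb R x x'))])
      MeasurableSet.univ (@MeasurableSet.univ _ (hist Y H n))
    rw [ENNReal.ofReal_of_nonpos hx, mul_zero, mul_zero] at this
    refine measure_mono_null (fun ω hω => ?_) this
    exact ⟨trivial, ⟨hω.1, trivial⟩, hω.2⟩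
  refine measure_mono_null (fun ω hω => ?_) (measure_iUnion_null fun x : S =>
    measure_iUnion_null fun x' : S => measure_iUnion_null fun hx : jumpProb R x x' ≤ 0 =>
      h x x' hx)
  simp only [Set.mem_compl_iff, Set.mem_ofPred_eq, not_lt] at hω
  simp only [Set.mem_iUnion]
  exact ⟨Y n ω, Y (n + 1) ω, hω, rfl, rfl⟩

omit [Countable S] in
lemma IsCTMC.ae_start [IsProbabilityMeasure P] (hC : IsCTMC R x₀ P Y H)
    (hR : ∀ x, 0 < exitRate R x) : ∀ᵐ ω ∂P, Y 0 ω = x₀ := by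
  have h := hC.measure_histCylinder hR 0 (fun _ => x₀) (B := fun _ => Set.univ)
    (fun _ => MeasurableSet.univ)
  have hset : histCylinder Y H 0 (fun _ => x₀) (fun _ => Set.univ) = {ω | Y 0 ω = x₀} := by
    ext ω
    simp [histCylinder]
  rw [hset] at h
  simp only [if_true, Finset.range_zero, Finset.prod_empty, mul_one] at h
  exact (prob_compl_eq_zero_iff (hC.measurableSet_Y 0 x₀)).2 h

end AlmostSure

/-! ### The events of exactly `n` jumps. -/

section Alive

variable {Ω : Type*} [MeasurableSpace Ω] {P : Measure Ω}

/-- The event that exactly `n` jumps happened up to time `t`. -/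
def currentJump (H : ℕ → Ω → ℝ) (n : ℕ) (t : ℝ) : Set Ω :=
  {ω | jumpTime H n ω ≤ t ∧ t < jumpTime H (n + 1) ω}

omit [MeasurableSpace Ω] in
lemma monotone_jumpTime {H : ℕ → Ω → ℝ} {ω : Ω} (hω : ∀ n, 0 ≤ H n ω) :
    Monotone fun n => jumpTime H n ω :=
  monotone_nat_of_le_succ fun n => by
    simp only [jumpTime, Finset.sum_range_succ]
    linarith [hω n]

-- For nonnegative holding times the jump times increase, so the set in the `sSup` of `jumpCount` is
-- `Set.Iic n`; in particular it is bounded.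
omit [MeasurableSpace Ω] in
lemma jumpCount_eq {H : ℕ → Ω → ℝ} {ω : Ω} (hω : ∀ n, 0 ≤ H n ω) {n : ℕ} {t : ℝ}
    (h : ω ∈ currentJump H n t) : jumpCount H t ω = n := by
  have hset : {m | jumpTime H m ω ≤ t} = Set.Iic n := by
    ext m
    simp only [Set.mem_ofPred_eq, Set.mem_Iic]
    constructor
    · intro hm
      by_contra hmn
      have := monotone_jumpTime hω (Nat.succ_le_of_lt (not_le.1 hmn))
      dsimp only at this
      exact absurd (h.2.trans_le this) (not_lt.2 hm)
    · intro hm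
      exact (monotone_jumpTime hω hm).trans h.1
  rw [jumpCount, hset, csSup_Iic]

variable {S : Type*} [DecidableEq S] [Countable S]
  {R : S → S → ℝ} {x₀ : S} {Y : ℕ → Ω → S} {H : ℕ → Ω → ℝ}

omit [Countable S] in
lemma IsCTMC.measurableSet_currentJump (hC : IsCTMC R x₀ P Y H) (n : ℕ) (t : ℝ) :
    MeasurableSet (currentJump H n t) :=
  (measurableSet_le (hC.measurable_jumpTime n) measurable_const).inter
    (measurableSet_lt measurable_const (hC.measurable_jumpTime (n + 1)))

lemma IsCTMC.aedisjoint_currentJump [IsFiniteMeasure P] (hC : IsCTMC R x₀ P Y H)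
    (hR : ∀ x, 0 < exitRate R x) (t : ℝ) :
    Pairwise (Function.onFun (AEDisjoint P) fun n => currentJump H n t) := by
  intro m n hmn
  refine measure_mono_null (fun ω hω => ?_) (hC.ae_nonneg hR)
  intro h
  exact hmn ((jumpCount_eq h hω.1).symm.trans (jumpCount_eq h hω.2))

/-- Disjointness gives only total mass at most `1`; equality is non-explosion, which does not hold
for every chain. -/
lemma IsCTMC.summable_real_currentJump [IsProbabilityMeasure P] (hC : IsCTMC R x₀ P Y H)
    (hR : ∀ x, 0 < exitRate R x) (t : ℝ) :
    Summable (fun n => P.real (currentJump H n t)) ∧ ∑' n, P.real (currentJump H n t) ≤ 1 := by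
  have h : ∀ s : Finset ℕ, ∑ n ∈ s, P.real (currentJump H n t) ≤ 1 := fun s => by
    have h1 := sum_measure_le_measure_univ (μ := P) (s := s) (t := fun n => currentJump H n t)
      (fun n _ => (hC.measurableSet_currentJump n t).nullMeasurableSet)
      (fun m _ n _ hmn => hC.aedisjoint_currentJump hR t hmn)
    rw [measure_univ] at h1
    have h2 := ENNReal.toReal_mono ENNReal.one_ne_top h1
    rwa [ENNReal.toReal_sum (fun _ _ => measure_ne_top _ _), ENNReal.toReal_one] at h2
  exact ⟨summable_of_sum_le (fun _ => measureReal_nonneg) h,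
    Real.tsum_le_of_sum_le (fun _ => measureReal_nonneg) h⟩

omit [Countable S] in
lemma measurable_decayMean [IsFiniteMeasure P] (hC : IsCTMC R x₀ P Y H) (n : ℕ) (C : Set S)
    {W : Ω → ℝ} (hW : Measurable W) (κ : ℝ) : Measurable (decayMean P Y H n C W κ) := by
  have := hC.measurable_jumpTime n
  have h : Measurable fun z : ℝ × Ω => W z.2 * decay κ (z.1 - jumpTime H n z.2) := by fun_prop
  exact (h.stronglyMeasurable.integral_prod_right' (ν := P.restrict {ω | Y n ω ∈ C})).measurable

end Alive

/-! ### The kernels as probabilities and means at time `t`. -/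

section Total

variable {Ω : Type*} [MeasurableSpace Ω] {P : Measure Ω} [IsProbabilityMeasure P]
  {Y : ℕ → Ω → Option ℕ} {H : ℕ → Ω → ℝ} {lam mu q p : ℝ}

lemma emptyMean_eq (hsys : Is1G1B lam mu q p P Y H) (hlam : 0 < lam) (hα : 0 < mu + lam * q)
    (hβ : 0 ≤ mu + lam * q * (1 - p)) (hν : 0 ≤ lam * q * p) (n : ℕ) (t : ℝ) :
    emptyMean P lam Y H n t = P.real ({ω | Y n ω = none} ∩ currentJump H n t) := by
  have h := IsCTMC.setIntegral_survival hsys (exitRate_pos (p := p) hlam hα) n hlam (C := {none})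
    (fun x hx => by rw [Set.mem_singleton_iff.1 hx]; exact exitRate_none)
    (fun x _ => tsum_jumpProb hlam hα hβ hν x) (W := fun _ => 1)
    (@measurable_const _ _ _ (hist Y H n) 1) (K := 1) (fun _ => by simp) t
  have hind : (fun ω => if jumpTime H n ω ≤ t ∧ t < jumpTime H (n + 1) ω then (1 : ℝ) else 0) =
      (currentJump H n t).indicator 1 := by
    ext ω
    simp [Set.indicator_apply, currentJump]
  have hm := IsCTMC.measurableSet_currentJump hsys n t
  rw [hind, integral_indicator_one hm, measureReal_restrict_apply hm] at h
  rw [emptyMean, ← h, Set.inter_comm]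
  rfl

lemma linkMean_eq (hsys : Is1G1B lam mu q p P Y H) (hlam : 0 < lam) (hα : 0 < mu + lam * q)
    (hβ : 0 ≤ mu + lam * q * (1 - p)) (hν : 0 ≤ lam * q * p) (n : ℕ) (t : ℝ) :
    linkMean P (mu + lam * q) Y H n t = P.real ({ω | Y n ω ≠ none} ∩ currentJump H n t) := by
  have h := IsCTMC.setIntegral_survival hsys (exitRate_pos (p := p) hlam hα) n hα (C := {none}ᶜ)
    (fun x hx => exitRate_of_mem_compl hx)
    (fun x _ => tsum_jumpProb hlam hα hβ hν x) (W := fun _ => 1)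
    (@measurable_const _ _ _ (hist Y H n) 1) (K := 1) (fun _ => by simp) t
  have hind : (fun ω => if jumpTime H n ω ≤ t ∧ t < jumpTime H (n + 1) ω then (1 : ℝ) else 0) =
      (currentJump H n t).indicator 1 := by
    ext ω
    simp [Set.indicator_apply, currentJump]
  have hm := IsCTMC.measurableSet_currentJump hsys n t
  rw [hind, integral_indicator_one hm, measureReal_restrict_apply hm] at h
  rw [linkMean, ← h, Set.inter_comm]
  rfl

lemma emptyMean_add_linkMean (hsys : Is1G1B lam mu q p P Y H) (hlam : 0 < lam)
    (hα : 0 < mu + lam * q) (hβ : 0 ≤ mu + lam * q * (1 - p)) (hν : 0 ≤ lam * q * p) (n : ℕ)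
    (t : ℝ) :
    emptyMean P lam Y H n t + linkMean P (mu + lam * q) Y H n t = P.real (currentJump H n t) := by
  rw [emptyMean_eq hsys hlam hα hβ hν, linkMean_eq hsys hlam hα hβ hν]
  have h := measureReal_inter_add_sdiff (μ := P) (s := currentJump H n t)
    (IsCTMC.measurableSet_Y hsys n none)
  rw [← h, Set.inter_comm, Set.inter_comm {ω | Y n ω ≠ none}]
  rfl

lemma depol_eq_decay {Γ t F : ℝ} (ht : 0 ≤ t) : depol Γ t F = (F - 1 / 4) * decay Γ t + 1 / 4 := by
  rw [depol, decay_of_nonneg ht, neg_mul]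
  ring

/-- The mean of the decayed fidelity on the event that the link present at time `t` was entered at
the `n`-th jump. -/
lemma excessMean_eq (hsys : Is1G1B lam mu q p P Y H) (hlam : 0 < lam) (hα : 0 < mu + lam * q)
    (hβ : 0 ≤ mu + lam * q * (1 - p)) (hν : 0 ≤ lam * q * p) {Γ a b F₀ : ℝ} (hΓ : 0 ≤ Γ)
    (hJ : ∀ F ∈ Set.Icc (0 : ℝ) 1, a * F + b ∈ Set.Icc 0 1) (n : ℕ) (t : ℝ) :
    ∫ ω in {ω | Y n ω ≠ none} ∩ currentJump H n t,
        depol Γ (t - jumpTime H n ω) (entryFidelity Γ a b F₀ Y H n ω) ∂P =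
      excessMean P (mu + lam * q) Γ a b F₀ Y H n t +
        1 / 4 * linkMean P (mu + lam * q) Y H n t := by
  have hGb := abs_entryFidelity_sub_quarter_le (Y := Y) (H := H) (F₀ := F₀) hΓ hJ n
  have hG := measurable_hist_entryFidelity Γ a b F₀ Y H n
  have hT := measurable_hist_jumpTime Y H n
  have hW : Measurable[hist Y H n] fun ω => (entryFidelity Γ a b F₀ Y H n ω - 1 / 4) *
      decay Γ (t - jumpTime H n ω) := by
    let _ := hist Y H n
    fun_prop
  have h := IsCTMC.setIntegral_survival hsys (exitRate_pos (p := p) hlam hα) n hα (C := {none}ᶜ)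
    (fun x hx => exitRate_of_mem_compl hx)
    (fun x _ => tsum_jumpProb hlam hα hβ hν x) hW
    (K := (max (1 / 2) |F₀ - 1 / 2| + 1 / 4) * 1) (fun ω => by
      rw [abs_mul]
      exact mul_le_mul (hGb ω) (abs_decay_le_one hΓ _) (abs_nonneg _)
        ((abs_nonneg _).trans (hGb ω))) t
  have hm := IsCTMC.measurableSet_currentJump hsys n t
  have hmY : MeasurableSet {ω | Y n ω ≠ none} := IsCTMC.measurableSet_mem hsys n {none}ᶜ
  -- Survival at rate `α` and decoherence at rate `Γ` over the same elapsed time multiply to one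
  -- kernel of rate `α + Γ`.
  have hdec : decayMean P Y H n {none}ᶜ (fun ω => (entryFidelity Γ a b F₀ Y H n ω - 1 / 4) *
      decay Γ (t - jumpTime H n ω)) (mu + lam * q) t =
      excessMean P (mu + lam * q) Γ a b F₀ Y H n t := by
    rw [excessMean, decayMean, decayMean]
    congr 1 with ω
    rw [mul_assoc]
    congr 1
    rcases lt_or_ge (t - jumpTime H n ω) 0 with hu | hu
    · rw [decay_of_neg hu, decay_of_neg hu, decay_of_neg hu, zero_mul]
    · rw [decay_of_nonneg hu, decay_of_nonneg hu, decay_of_nonneg hu, ← Real.exp_add]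
      congr 1
      ring
  rw [hdec] at h
  have hind : (fun ω => if jumpTime H n ω ≤ t ∧ t < jumpTime H (n + 1) ω then
      (entryFidelity Γ a b F₀ Y H n ω - 1 / 4) * decay Γ (t - jumpTime H n ω) else 0) =
      (currentJump H n t).indicator fun ω => (entryFidelity Γ a b F₀ Y H n ω - 1 / 4) *
        decay Γ (t - jumpTime H n ω) := by
    ext ω
    simp [Set.indicator_apply, currentJump]
  rw [hind, setIntegral_indicator hm] at h
  rw [← h, linkMean_eq hsys hlam hα hβ hν]
  have hi : Integrable (fun ω => (entryFidelity Γ a b F₀ Y H n ω - 1 / 4) *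
        decay Γ (t - jumpTime H n ω)) P :=
    IsCTMC.integrable_mul_decay_jumpTime hsys n
      ((hG.mono (IsCTMC.hist_le hsys n) le_rfl).sub_const _) hGb hΓ t
  have hc : ∫ ω in {ω | Y n ω ≠ none} ∩ currentJump H n t, (1 / 4 : ℝ) ∂P =
      1 / 4 * P.real ({ω | Y n ω ≠ none} ∩ currentJump H n t) := by
    rw [setIntegral_const, smul_eq_mul, mul_comm]
  rw [← hc]
  have hset : {ω | Y n ω ∈ ({none}ᶜ : Set (Option ℕ))} = {ω | Y n ω ≠ none} := rfl
  rw [hset, ← integral_add hi.integrableOn (integrable_const _)]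
  refine setIntegral_congr_fun (hmY.inter hm) fun ω hω => ?_
  exact depol_eq_decay (sub_nonneg.2 hω.2.1)

lemma abs_excessMean_le (hsys : Is1G1B lam mu q p P Y H) (hα : 0 < mu + lam * q) {Γ a b F₀ : ℝ}
    (hΓ : 0 ≤ Γ) (hJ : ∀ F ∈ Set.Icc (0 : ℝ) 1, a * F + b ∈ Set.Icc 0 1) (n : ℕ) (t : ℝ) :
    |excessMean P (mu + lam * q) Γ a b F₀ Y H n t| ≤
      (max (1 / 2) |F₀ - 1 / 2| + 1 / 4) * linkMean P (mu + lam * q) Y H n t := by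
  have hGb := abs_entryFidelity_sub_quarter_le (Y := Y) (H := H) (F₀ := F₀) hΓ hJ n
  have hi := IsCTMC.integrable_mul_decay_jumpTime hsys n (W := fun _ => 1)
      measurable_const (K := 1) (fun _ => by simp) hα.le t
  rw [linkMean, decayMean, ← integral_const_mul, ← Real.norm_eq_abs]
  refine norm_integral_le_of_norm_le (hi.integrableOn.const_mul _)
    (Filter.Eventually.of_forall fun ω => ?_)
  rw [norm_mul, Real.norm_eq_abs, Real.norm_of_nonneg (decay_nonneg _ _), one_mul]
  refine mul_le_mul (hGb ω) ?_ (decay_nonneg _ _) ((abs_nonneg _).trans (hGb ω))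
  rcases lt_or_ge (t - jumpTime H n ω) 0 with hu | hu
  · rw [decay_of_neg hu, decay_of_neg hu]
  · rw [decay_of_nonneg hu, decay_of_nonneg hu]
    refine Real.exp_le_exp.2 ?_
    nlinarith

end Total

/-! ### The fidelity along a single path. -/

section Path

variable {Ω : Type*} {Y : ℕ → Ω → Option ℕ} {H : ℕ → Ω → ℝ} {ω : Ω}

/-- `Y · ω` starts in the empty state and moves along the allowed transitions. -/
def IsBufferPath (Y : ℕ → Ω → Option ℕ) (ω : Ω) : Prop :=
  Y 0 ω = none ∧ ∀ n j, Y (n + 1) ω = some j →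
    (Y n ω = none ∧ j = 0) ∨ ∃ i, Y n ω = some i ∧ j = i + 1

/-- Level `i + 1` can be entered only from level `i`, and level `0` only from the empty state.
Walking back from `some i` therefore finds an uninterrupted climb that starts after an empty state
at step `M`. -/
lemma IsBufferPath.exists_start (hY : IsBufferPath Y ω) {i : ℕ} :
    ∀ {n : ℕ}, Y n ω = some i →
      ∃ M, n = M + 1 + i ∧ Y M ω = none ∧ ∀ j ≤ i, Y (M + 1 + j) ω = some j := by
  induction i with
  | zero =>
    rintro (_ | n) hn
    · simp [hY.1] at hn
    · rcases hY.2 n 0 hn with ⟨h, -⟩ | ⟨i, -, h⟩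
      · refine ⟨n, rfl, h, fun j hj => ?_⟩
        rw [Nat.le_zero.1 hj]
        exact hn
      · omega
  | succ i ih =>
    rintro (_ | n) hn
    · simp [hY.1] at hn
    · rcases hY.2 n (i + 1) hn with ⟨-, h⟩ | ⟨i', h, hi⟩
      · omega
      · obtain rfl : i = i' := by omega
        obtain ⟨M, rfl, hM, hj⟩ := ih h
        refine ⟨M, rfl, hM, fun j hji => ?_⟩
        rcases Nat.lt_or_ge i j with h' | h'
        · obtain rfl : j = i + 1 := by omega
          exact hn
        · exact hj j h'

/-- Along one climb, the recursion over levels and the recursion over jumps apply the same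
operations, the latter restarting at the empty state `Y M`. The last time stays free because the
current visit is still running. -/
lemma levelFidelity_eq_depol {Γ a b : ℝ} {J : ℝ → TwoQubitState → ℝ} {ρ : TwoQubitState}
    (hJ : ∀ F, J F ρ = a * F + b) (hH : ∀ n, 0 ≤ H n ω) {M : ℕ} (hM : Y M ω = none) {i : ℕ}
    (hY : ∀ j ≤ i, Y (M + 1 + j) ω = some j) (τ : Fin (i + 1) → ℝ)
    (hτ : ∀ j : Fin (i + 1), (j : ℕ) < i → τ j = H (M + 1 + j) ω) :
    levelFidelity Γ J ρ i τ =
      depol Γ (τ (Fin.last i)) (entryFidelity Γ a b ρ.fidelity Y H (M + 1 + i) ω) := by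
  induction i with
  | zero => simp [levelFidelity, entryFidelity, hM]
  | succ i ih =>
    have h := ih (fun j hj => hY j (by omega)) (fun j => τ j.castSucc)
      (fun j hj => hτ j.castSucc (by simp; omega))
    have hlast : τ (Fin.last i).castSucc = H (M + 1 + i) ω := by
      simpa using hτ (Fin.last i).castSucc (by simp)
    rw [levelFidelity, h, hJ, hlast, ← add_assoc (M + 1) i 1, entryFidelity,
      if_neg (by simp [hY i (by omega)]), abs_of_nonneg (hH _)]

/-- The fidelity of the system at a time `t` between the `n`-th and the `(n + 1)`-st jump. -/
lemma systemFidelity_eq {Γ a b : ℝ} {J : ℝ → TwoQubitState → ℝ} {ρ : TwoQubitState}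
    (hJ : ∀ F, J F ρ = a * F + b) (hH : ∀ n, 0 ≤ H n ω) (hY : IsBufferPath Y ω) {n : ℕ} {t : ℝ}
    (hn : ω ∈ currentJump H n t) :
    systemFidelity Γ J ρ Y H t ω = if Y n ω = none then 0 else
      depol Γ (t - jumpTime H n ω) (entryFidelity Γ a b ρ.fidelity Y H n ω) := by
  have hN := jumpCount_eq hH hn
  have hs : stateAt Y H t ω = Y n ω := by rw [stateAt, hN]
  unfold systemFidelity
  rw [hs]
  rcases hYn : Y n ω with _ | i
  · simp
  · obtain ⟨M, rfl, hM, hj⟩ := hY.exists_start hYn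
    simp only [reduceCtorEq, if_false]
    rw [levelFidelity_eq_depol hJ hH hM hj]
    · simp [levelTimes, hN]
    · intro j hji
      rw [levelTimes, if_neg hji.ne, hN]
      congr 1
      -- Levels strictly increase during the current climb, so its visit to level `j`, at step `M +
      -- 1 + j`, is the most recent one.
      rw [Nat.findGreatest_eq_iff]
      refine ⟨by omega, fun _ => hj j hji.le, fun m hm hm' h => ?_⟩
      have h2 := hj (m - (M + 1)) (by omega)
      rw [show M + 1 + (m - (M + 1)) = m by omega, h, Option.some_inj] at h2
      omega

end Path

/-! ### The summed equations and non-explosion. -/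

section Total

variable {Ω : Type*} [MeasurableSpace Ω] {P : Measure Ω} [IsProbabilityMeasure P]
  {Y : ℕ → Ω → Option ℕ} {H : ℕ → Ω → ℝ} {lam mu q p : ℝ}

lemma ae_isBufferPath (hsys : Is1G1B lam mu q p P Y H) (hlam : 0 < lam) (hα : 0 < mu + lam * q) :
    ∀ᵐ ω ∂P, IsBufferPath Y ω := by
  have hR := exitRate_pos (p := p) hlam hα
  filter_upwards [IsCTMC.ae_start hsys hR, IsCTMC.ae_jumpProb_pos hsys hR] with ω h0 hpos
  refine ⟨h0, fun n j hj => ?_⟩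
  have h := hpos n
  rw [hj] at h
  rcases hn : Y n ω with _ | i
  · rw [hn, jumpProb_none_some hlam] at h
    by_cases hj0 : j = 0
    · exact Or.inl ⟨rfl, hj0⟩
    · simp [hj0] at h
  · rw [hn, jumpProb_some_some] at h
    by_cases hji : j = i + 1
    · exact Or.inr ⟨i, rfl, hji⟩
    · simp [hji] at h

lemma emptyMean_zero (hsys : Is1G1B lam mu q p P Y H) (hlam : 0 < lam) (hα : 0 < mu + lam * q)
    (t : ℝ) : emptyMean P lam Y H 0 t = decay lam t := by
  have h0 := IsCTMC.ae_start hsys (exitRate_pos (p := p) hlam hα)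
  have hset : {ω | Y 0 ω ∈ ({none} : Set (Option ℕ))} =ᵐ[P] Set.univ := by
    filter_upwards [h0] with ω hω
    exact eq_true (show Y 0 ω = none from hω)
  rw [emptyMean, decayMean, setIntegral_congr_set hset]
  simp [jumpTime]

lemma decayMean_zero_link (hsys : Is1G1B lam mu q p P Y H) (hlam : 0 < lam)
    (hα : 0 < mu + lam * q) (W : Ω → ℝ) (κ t : ℝ) : decayMean P Y H 0 {none}ᶜ W κ t = 0 :=
  setIntegral_measure_zero _ (IsCTMC.ae_start hsys (exitRate_pos (p := p) hlam hα))

/-- The probability that the system is empty at time `t`, as a series over the jumps. -/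
def totalEmpty (P : Measure Ω) (lam : ℝ) (Y : ℕ → Ω → Option ℕ) (H : ℕ → Ω → ℝ) (t : ℝ) : ℝ :=
  ∑' n, emptyMean P lam Y H n t

/-- The probability that there is a link at time `t`, as a series over the jumps. -/
def totalLink (P : Measure Ω) (α : ℝ) (Y : ℕ → Ω → Option ℕ) (H : ℕ → Ω → ℝ) (t : ℝ) : ℝ :=
  ∑' n, linkMean P α Y H n t

/-- The mean excess of the fidelity at time `t`, as a series over the jumps. -/
def totalExcess (P : Measure Ω) (α Γ a b F₀ : ℝ) (Y : ℕ → Ω → Option ℕ) (H : ℕ → Ω → ℝ)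
    (t : ℝ) : ℝ :=
  ∑' n, excessMean P α Γ a b F₀ Y H n t

lemma emptyMean_nonneg (P : Measure Ω) (Y : ℕ → Ω → Option ℕ) (H : ℕ → Ω → ℝ) (n : ℕ)
    (lam t : ℝ) : 0 ≤ emptyMean P lam Y H n t :=
  integral_nonneg fun _ => mul_nonneg zero_le_one (decay_nonneg _ _)

lemma linkMean_nonneg (P : Measure Ω) (Y : ℕ → Ω → Option ℕ) (H : ℕ → Ω → ℝ) (n : ℕ)
    (α t : ℝ) : 0 ≤ linkMean P α Y H n t :=
  integral_nonneg fun _ => mul_nonneg zero_le_one (decay_nonneg _ _)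

section

variable (hsys : Is1G1B lam mu q p P Y H) (hlam : 0 < lam) (hα : 0 < mu + lam * q)
  (hβ : 0 ≤ mu + lam * q * (1 - p)) (hν : 0 ≤ lam * q * p)

include hsys hlam hα hβ hν

lemma summable_emptyMean (t : ℝ) : Summable (fun n => |emptyMean P lam Y H n t|) ∧
    ∑' n, |emptyMean P lam Y H n t| ≤ 1 := by
  have h := IsCTMC.summable_real_currentJump hsys (exitRate_pos (p := p) hlam hα) t
  have hle : ∀ n, |emptyMean P lam Y H n t| ≤ P.real (currentJump H n t) := fun n => by
    rw [abs_of_nonneg (emptyMean_nonneg ..), ← emptyMean_add_linkMean hsys hlam hα hβ hν]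
    exact le_add_of_nonneg_right (linkMean_nonneg ..)
  have hs := Summable.of_nonneg_of_le (fun n => abs_nonneg _) hle h.1
  exact ⟨hs, (hs.tsum_le_tsum hle h.1).trans h.2⟩

lemma summable_linkMean (t : ℝ) : Summable (fun n => |linkMean P (mu + lam * q) Y H n t|) ∧
    ∑' n, |linkMean P (mu + lam * q) Y H n t| ≤ 1 := by
  have h := IsCTMC.summable_real_currentJump hsys (exitRate_pos (p := p) hlam hα) t
  have hle : ∀ n, |linkMean P (mu + lam * q) Y H n t| ≤ P.real (currentJump H n t) := fun n => by
    rw [abs_of_nonneg (linkMean_nonneg ..), ← emptyMean_add_linkMean hsys hlam hα hβ hν]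
    exact le_add_of_nonneg_left (emptyMean_nonneg ..)
  have hs := Summable.of_nonneg_of_le (fun n => abs_nonneg _) hle h.1
  exact ⟨hs, (hs.tsum_le_tsum hle h.1).trans h.2⟩

lemma summable_excessMean {Γ a b F₀ : ℝ} (hΓ : 0 ≤ Γ)
    (hJ : ∀ F ∈ Set.Icc (0 : ℝ) 1, a * F + b ∈ Set.Icc 0 1) (t : ℝ) :
    Summable (fun n => |excessMean P (mu + lam * q) Γ a b F₀ Y H n t|) ∧
      ∑' n, |excessMean P (mu + lam * q) Γ a b F₀ Y H n t| ≤ max (1 / 2) |F₀ - 1 / 2| + 1 / 4 := by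
  obtain ⟨hs, h1⟩ := summable_linkMean hsys hlam hα hβ hν t
  have hK : 0 ≤ max (1 / 2) |F₀ - 1 / 2| + 1 / 4 := by positivity
  have hle : ∀ n, |excessMean P (mu + lam * q) Γ a b F₀ Y H n t| ≤
      (max (1 / 2) |F₀ - 1 / 2| + 1 / 4) * |linkMean P (mu + lam * q) Y H n t| := fun n => by
    rw [abs_of_nonneg (linkMean_nonneg ..)]
    exact abs_excessMean_le hsys hα hΓ hJ n t
  have hs' := Summable.of_nonneg_of_le (fun n => abs_nonneg _) hle (hs.mul_left _)
  refine ⟨hs', (hs'.tsum_le_tsum hle (hs.mul_left _)).trans ?_⟩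
  rw [tsum_mul_left]
  exact mul_le_of_le_one_right hK h1

lemma hasSum_emptyMean_decay {κ : ℝ} (hκ : 0 < κ) (t : ℝ) :
    HasSum (fun n => ∫ s, emptyMean P lam Y H n s * decay κ (t - s))
      (∫ s, totalEmpty P lam Y H s * decay κ (t - s)) :=
  hasSum_integral_mul_decay
    (fun n => measurable_decayMean hsys n _ measurable_const _)
    (fun s => (summable_emptyMean hsys hlam hα hβ hν s).1)
    (fun s => (summable_emptyMean hsys hlam hα hβ hν s).2) hκ t

lemma hasSum_linkMean_decay {κ : ℝ} (hκ : 0 < κ) (t : ℝ) :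
    HasSum (fun n => ∫ s, linkMean P (mu + lam * q) Y H n s * decay κ (t - s))
      (∫ s, totalLink P (mu + lam * q) Y H s * decay κ (t - s)) :=
  hasSum_integral_mul_decay
    (fun n => measurable_decayMean hsys n _ measurable_const _)
    (fun s => (summable_linkMean hsys hlam hα hβ hν s).1)
    (fun s => (summable_linkMean hsys hlam hα hβ hν s).2) hκ t

omit hlam hα hβ hν in
lemma measurable_excessMean (Γ a b F₀ : ℝ) (n : ℕ) :
    Measurable (excessMean P (mu + lam * q) Γ a b F₀ Y H n) :=
  measurable_decayMean hsys n _ (((measurable_hist_entryFidelity Γ a b F₀ Y H n).mono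
    (IsCTMC.hist_le hsys n) le_rfl).sub_const _) _

lemma hasSum_excessMean_decay {Γ a b F₀ : ℝ} (hΓ : 0 ≤ Γ)
    (hJ : ∀ F ∈ Set.Icc (0 : ℝ) 1, a * F + b ∈ Set.Icc 0 1) {κ : ℝ} (hκ : 0 < κ) (t : ℝ) :
    HasSum (fun n => ∫ s, excessMean P (mu + lam * q) Γ a b F₀ Y H n s * decay κ (t - s))
      (∫ s, totalExcess P (mu + lam * q) Γ a b F₀ Y H s * decay κ (t - s)) :=
  hasSum_integral_mul_decay (measurable_excessMean hsys Γ a b F₀)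
    (fun s => (summable_excessMean hsys hlam hα hβ hν hΓ hJ s).1)
    (fun s => (summable_excessMean hsys hlam hα hβ hν hΓ hJ s).2) hκ t

lemma measurable_totalEmpty : Measurable (totalEmpty P lam Y H) :=
  measurable_tsum_of_summable (fun n => measurable_decayMean hsys n _ measurable_const _)
    (fun s => (summable_emptyMean hsys hlam hα hβ hν s).1.of_abs)

lemma measurable_totalLink : Measurable (totalLink P (mu + lam * q) Y H) :=
  measurable_tsum_of_summable (fun n => measurable_decayMean hsys n _ measurable_const _)
    (fun s => (summable_linkMean hsys hlam hα hβ hν s).1.of_abs)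

lemma measurable_totalExcess {Γ a b F₀ : ℝ} (hΓ : 0 ≤ Γ)
    (hJ : ∀ F ∈ Set.Icc (0 : ℝ) 1, a * F + b ∈ Set.Icc 0 1) :
    Measurable (totalExcess P (mu + lam * q) Γ a b F₀ Y H) :=
  measurable_tsum_of_summable (measurable_excessMean hsys Γ a b F₀)
    (fun s => (summable_excessMean hsys hlam hα hβ hν hΓ hJ s).1.of_abs)

lemma abs_totalEmpty_le (t : ℝ) : |totalEmpty P lam Y H t| ≤ 1 :=
  abs_tsum_le_of_summable_abs (summable_emptyMean hsys hlam hα hβ hν t).1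
    (summable_emptyMean hsys hlam hα hβ hν t).2

lemma abs_totalLink_le (t : ℝ) : |totalLink P (mu + lam * q) Y H t| ≤ 1 :=
  abs_tsum_le_of_summable_abs (summable_linkMean hsys hlam hα hβ hν t).1
    (summable_linkMean hsys hlam hα hβ hν t).2

/-- The term `n = 0` is the initial value, as the chain starts empty; the terms `n + 1` sum to the
convolution. -/
lemma isResponse_totalEmpty :
    IsResponse lam 1 (fun s => (mu + lam * q * (1 - p)) * totalLink P (mu + lam * q) Y H s)
      (totalEmpty P lam Y H) := by
  intro t
  have h := (summable_emptyMean hsys hlam hα hβ hν t).1.of_abs.tsum_eq_zero_add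
  rw [totalEmpty, h, emptyMean_zero hsys hlam hα, one_mul]
  simp only [emptyMean_succ hsys hlam hα hβ, mul_assoc, integral_const_mul]
  rw [((hasSum_linkMean_decay hsys hlam hα hβ hν hlam t).mul_left _).tsum_eq]

lemma isResponse_totalLink :
    IsResponse (mu + lam * q) 0 (fun s => lam * totalEmpty P lam Y H s +
      lam * q * p * totalLink P (mu + lam * q) Y H s) (totalLink P (mu + lam * q) Y H) := by
  intro t
  have h := (summable_linkMean hsys hlam hα hβ hν t).1.of_abs.tsum_eq_zero_add
  have hO := integrable_mul_decay hα (measurable_totalEmpty hsys hlam hα hβ hν)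
    (abs_totalEmpty_le hsys hlam hα hβ hν) t
  have hL := integrable_mul_decay hα (measurable_totalLink hsys hlam hα hβ hν)
    (abs_totalLink_le hsys hlam hα hβ hν) t
  have hsum := ((hasSum_emptyMean_decay hsys hlam hα hβ hν hα t).mul_left lam).add
    ((hasSum_linkMean_decay hsys hlam hα hβ hν hα t).mul_left (lam * q * p))
  rw [totalLink, h, linkMean, decayMean_zero_link hsys hlam hα, zero_mul]
  simp only [linkMean_succ hsys hlam hα hν]
  rw [hsum.tsum_eq, ← integral_const_mul, ← integral_const_mul,
    ← integral_add (hO.const_mul _) (hL.const_mul _)]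
  congr 2 with s
  ring

lemma isResponse_totalExcess {Γ a b F₀ : ℝ} (hΓ : 0 ≤ Γ)
    (hJ : ∀ F ∈ Set.Icc (0 : ℝ) 1, a * F + b ∈ Set.Icc 0 1) :
    IsResponse (mu + lam * q + Γ) 0 (fun s => lam * (F₀ - 1 / 4) * totalEmpty P lam Y H s +
      lam * q * p * (a * totalExcess P (mu + lam * q) Γ a b F₀ Y H s +
        (a / 4 + b - 1 / 4) * totalLink P (mu + lam * q) Y H s))
      (totalExcess P (mu + lam * q) Γ a b F₀ Y H) := by
  intro t
  have hκ : 0 < mu + lam * q + Γ := by linarith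
  have h := (summable_excessMean (F₀ := F₀) hsys hlam hα hβ hν hΓ hJ t).1.of_abs.tsum_eq_zero_add
  have hO := integrable_mul_decay hκ (measurable_totalEmpty hsys hlam hα hβ hν)
    (abs_totalEmpty_le hsys hlam hα hβ hν) t
  have hL := integrable_mul_decay hκ (measurable_totalLink hsys hlam hα hβ hν)
    (abs_totalLink_le hsys hlam hα hβ hν) t
  have hM := integrable_mul_decay hκ (measurable_totalExcess (F₀ := F₀) hsys hlam hα hβ hν hΓ hJ)
    (fun s => abs_tsum_le_of_summable_abs (summable_excessMean hsys hlam hα hβ hν hΓ hJ s).1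
      (summable_excessMean hsys hlam hα hβ hν hΓ hJ s).2) t
  have hsum := ((hasSum_emptyMean_decay hsys hlam hα hβ hν hκ t).mul_left
      (lam * (F₀ - 1 / 4))).add
    ((((hasSum_excessMean_decay (F₀ := F₀) hsys hlam hα hβ hν hΓ hJ hκ t).mul_left a).add
      ((hasSum_linkMean_decay hsys hlam hα hβ hν hκ t).mul_left (a / 4 + b - 1 / 4))).mul_left
        (lam * q * p))
  have hML : Integrable fun s => lam * q * p *
      (a * (totalExcess P (mu + lam * q) Γ a b F₀ Y H s * decay (mu + lam * q + Γ) (t - s)) +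
        (a / 4 + b - 1 / 4) *
          (totalLink P (mu + lam * q) Y H s * decay (mu + lam * q + Γ) (t - s))) :=
    ((hM.const_mul _).add (hL.const_mul _)).const_mul _
  rw [totalExcess, h, excessMean, decayMean_zero_link hsys hlam hα, zero_mul]
  simp only [excessMean_succ hsys hlam hα hν hΓ hJ]
  rw [hsum.tsum_eq, ← integral_const_mul, ← integral_const_mul, ← integral_const_mul,
    ← integral_add (hM.const_mul _) (hL.const_mul _), ← integral_const_mul,
    ← integral_add (hO.const_mul _) hML]
  congr 2 with s
  ring

/-- Disjointness of the events `currentJump` bounds the total mass by `1` from above, and the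
equations themselves bound it from below. Together they exclude infinitely many jumps before `t`. -/
lemma totalEmpty_add_totalLink {t : ℝ} (ht : 0 ≤ t) :
    totalEmpty P lam Y H t + totalLink P (mu + lam * q) Y H t = 1 ∧
      HasSum (fun n => P.real (currentJump H n t)) 1 := by
  have hO := summable_emptyMean hsys hlam hα hβ hν
  have hL := summable_linkMean hsys hlam hα hβ hν
  have h1 := one_le_add_of_isResponse hlam hα (β := mu + lam * q * (1 - p)) (ν := lam * q * p)
    (by ring) (measurable_totalEmpty hsys hlam hα hβ hν) (measurable_totalLink hsys hlam hα hβ hν)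
    (fun t => tsum_nonneg fun n => emptyMean_nonneg ..)
    (fun t => tsum_nonneg fun n => linkMean_nonneg ..)
    (fun t => (abs_le.1 (abs_totalEmpty_le hsys hlam hα hβ hν t)).2)
    (fun t => (abs_le.1 (abs_totalLink_le hsys hlam hα hβ hν t)).2)
    (isResponse_totalEmpty hsys hlam hα hβ hν) (isResponse_totalLink hsys hlam hα hβ hν) ht
  have hsum := (hO t).1.of_abs.hasSum.add (hL t).1.of_abs.hasSum
  simp only [emptyMean_add_linkMean hsys hlam hα hβ hν] at hsum
  have hle := (IsCTMC.summable_real_currentJump hsys (exitRate_pos (p := p) hlam hα) t).2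
  rw [hsum.tsum_eq] at hle
  have heq : totalEmpty P lam Y H t + totalLink P (mu + lam * q) Y H t = 1 := le_antisymm hle h1
  refine ⟨heq, ?_⟩
  rw [← heq]
  exact hsum

/-- Almost surely, only finitely many jumps happened up to time `t`. -/
lemma ae_exists_currentJump {t : ℝ} (ht : 0 ≤ t) : ∀ᵐ ω ∂P, ∃ n, ω ∈ currentJump H n t := by
  have hR := exitRate_pos (p := p) hlam hα
  have hm := IsCTMC.measurableSet_currentJump hsys (t := t)
  have h1 := measure_iUnion₀ (IsCTMC.aedisjoint_currentJump hsys hR t)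
    (fun n => (hm n).nullMeasurableSet)
  have h2 := (totalEmpty_add_totalLink hsys hlam hα hβ hν ht).2
  have h3 : P (⋃ n, currentJump H n t) = 1 := by
    rw [h1]
    have h4 := ENNReal.ofReal_tsum_of_nonneg (fun n => measureReal_nonneg) h2.summable
    rw [h2.tsum_eq, ENNReal.ofReal_one] at h4
    rw [h4]
    simp only [ofReal_measureReal (measure_ne_top P _)]
  have h4 := (prob_compl_eq_zero_iff (MeasurableSet.iUnion hm)).2 h3
  have h5 : ∀ᵐ ω ∂P, ω ∈ ⋃ n, currentJump H n t := h4
  filter_upwards [h5] with ω hω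
  exact Set.mem_iUnion.1 hω

end

end Total

/-! ### The average fidelity after `i` rounds. -/

section LevelAverage

lemma integrable_exp_expMeasure {r Γ : ℝ} (hr : 0 < r) (hΓ : 0 ≤ Γ) :
    Integrable (fun h => Real.exp (-Γ * h)) (expMeasure r) := by
  have := isProbabilityMeasure_expMeasure hr
  refine Integrable.of_bound (C := 1) (Measurable.aestronglyMeasurable (by fun_prop)) ?_
  have h0 : ∀ᵐ h ∂(expMeasure r), 0 ≤ h := by
    refine measure_mono_null (fun h hh => ?_) (expMeasure_Iio (r := r))
    exact not_le.1 (show ¬ 0 ≤ h from hh)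
  filter_upwards [h0] with h hh
  rw [Real.norm_eq_abs, Real.abs_exp]
  exact Real.exp_le_one_iff.2 (by nlinarith)

lemma integral_exp_expMeasure {r Γ : ℝ} (hr : 0 < r) (hΓ : 0 ≤ Γ) :
    ∫ h, Real.exp (-Γ * h) ∂(expMeasure r) = r / (r + Γ) := by
  have h : ∀ h, decay r h * Real.exp (-Γ * h) = decay (r + Γ) h := fun h => by
    rcases lt_or_ge h 0 with hh | hh
    · rw [decay_of_neg hh, decay_of_neg hh, zero_mul]
    · rw [decay_of_nonneg hh, decay_of_nonneg hh, ← Real.exp_add]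
      congr 1
      ring
  rw [integral_expMeasure hr]
  simp only [h]
  rw [integral_decay (by linarith), mul_one_div]

lemma levelFidelity_zero_average {r Γ : ℝ} (hr : 0 < r) (hΓ : 0 ≤ Γ)
    (J : ℝ → TwoQubitState → ℝ) (ρ : TwoQubitState) :
    Integrable (levelFidelity Γ J ρ 0) (iidExp r 0) ∧
      ∫ t, levelFidelity Γ J ρ 0 t ∂(iidExp r 0) =
        r / (r + Γ) * (ρ.fidelity - 1 / 4) + 1 / 4 := by
  have := isProbabilityMeasure_expMeasure hr
  have hmp := measurePreserving_eval (fun _ : Fin (0 + 1) => expMeasure r) 0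
  have hi : Integrable (fun h => depol Γ h ρ.fidelity) (expMeasure r) :=
    ((integrable_exp_expMeasure hr hΓ).mul_const _).add (integrable_const _)
  have hf : levelFidelity Γ J ρ 0 = (fun h => depol Γ h ρ.fidelity) ∘ Function.eval 0 := rfl
  rw [hf]
  refine ⟨hmp.integrable_comp_of_integrable hi, ?_⟩
  have h1 := integral_map (μ := iidExp r 0) hmp.measurable.aemeasurable
    (f := fun h => depol Γ h ρ.fidelity) (by rw [iidExp, hmp.map_eq]; exact hi.aestronglyMeasurable)
  rw [iidExp, hmp.map_eq] at h1
  refine h1.symm.trans ?_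
  unfold depol
  rw [integral_add ((integrable_exp_expMeasure hr hΓ).mul_const _) (integrable_const _),
    integral_mul_const, integral_exp_expMeasure hr hΓ]
  simp

/-- Splitting off the last coordinate turns the law into a product, and the integrand is a function
of that coordinate times a function of the others, up to a constant. -/
lemma levelFidelity_succ_average {r Γ a b : ℝ} (hr : 0 < r) (hΓ : 0 ≤ Γ)
    {J : ℝ → TwoQubitState → ℝ} {ρ : TwoQubitState} (hJ : ∀ F, J F ρ = a * F + b) {i : ℕ}
    (hi : Integrable (levelFidelity Γ J ρ i) (iidExp r i)) :
    Integrable (levelFidelity Γ J ρ (i + 1)) (iidExp r (i + 1)) ∧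
      ∫ t, levelFidelity Γ J ρ (i + 1) t ∂(iidExp r (i + 1)) =
        r / (r + Γ) * (a * (∫ t, levelFidelity Γ J ρ i t ∂(iidExp r i)) + b - 1 / 4) + 1 / 4 := by
  have := isProbabilityMeasure_expMeasure hr
  have hprob : IsProbabilityMeasure (iidExp r i) := by unfold iidExp; infer_instance
  have hmp := measurePreserving_piFinSuccAbove (fun _ : Fin (i + 1 + 1) => expMeasure r)
    (Fin.last (i + 1))
  have hab : Integrable (fun t => a * levelFidelity Γ J ρ i t + b) (iidExp r i) :=
    (hi.const_mul a).add (integrable_const _)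
  have hi' : Integrable (fun t => a * levelFidelity Γ J ρ i t + b - 1 / 4) (iidExp r i) :=
    hab.sub (integrable_const _)
  have hprod := (integrable_exp_expMeasure hr hΓ).mul_prod hi'
  have hg : Integrable (fun z : ℝ × (Fin (i + 1) → ℝ) =>
      Real.exp (-Γ * z.1) * (a * levelFidelity Γ J ρ i z.2 + b - 1 / 4) + 1 / 4)
      ((expMeasure r).prod (iidExp r i)) := hprod.add (integrable_const _)
  have hf : levelFidelity Γ J ρ (i + 1) = (fun z : ℝ × (Fin (i + 1) → ℝ) =>
      Real.exp (-Γ * z.1) * (a * levelFidelity Γ J ρ i z.2 + b - 1 / 4) + 1 / 4) ∘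
      MeasurableEquiv.piFinSuccAbove (fun _ => ℝ) (Fin.last (i + 1)) := by
    ext t
    have h2 : (MeasurableEquiv.piFinSuccAbove (fun _ : Fin (i + 1 + 1) => ℝ)
        (Fin.last (i + 1)) t) = (t (Fin.last (i + 1)), fun j => t j.castSucc) := by
      refine Prod.ext rfl (funext fun j => ?_)
      change t ((Fin.last (i + 1)).succAbove j) = _
      rw [Fin.succAbove_last]
    rw [Function.comp_apply, h2, levelFidelity, hJ, depol]
  rw [hf]
  refine ⟨hmp.integrable_comp_of_integrable hg, ?_⟩
  have h1 := hmp.integral_comp' (fun z : ℝ × (Fin (i + 1) → ℝ) =>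
      Real.exp (-Γ * z.1) * (a * levelFidelity Γ J ρ i z.2 + b - 1 / 4) + 1 / 4)
  refine h1.trans ?_
  change ∫ z, _ ∂((expMeasure r).prod (iidExp r i)) = _
  rw [integral_add hprod (integrable_const _),
    integral_prod_mul (fun h => Real.exp (-Γ * h))
      (fun t => a * levelFidelity Γ J ρ i t + b - 1 / 4), integral_exp_expMeasure hr hΓ,
    integral_sub hab (integrable_const _),
    integral_add (hi.const_mul a) (integrable_const _), integral_const_mul]
  simp

lemma abs_slope_le_one {a b : ℝ} (hJ : ∀ F ∈ Set.Icc (0 : ℝ) 1, a * F + b ∈ Set.Icc 0 1) :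
    |a| ≤ 1 := by
  have h0 := hJ 0 (by simp)
  have h1 := hJ 1 (by simp)
  simp only [mul_zero, zero_add, mul_one, Set.mem_Icc] at h0 h1
  rw [abs_le]
  constructor <;> linarith

lemma levelFidelity_average {r Γ a b : ℝ} (hr : 0 < r) (hΓ : 0 ≤ Γ)
    {J : ℝ → TwoQubitState → ℝ} {ρ : TwoQubitState} (hJ : ∀ F, J F ρ = a * F + b)
    (hJr : ∀ F ∈ Set.Icc (0 : ℝ) 1, a * F + b ∈ Set.Icc 0 1) (i : ℕ) :
    Integrable (levelFidelity Γ J ρ i) (iidExp r i) ∧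
      ∫ t, levelFidelity Γ J ρ i t ∂(iidExp r i) =
        1 / 4 + (ρ.fidelity - 1 / 4) * a ^ i * (r / (r + Γ)) ^ (i + 1) +
          (a / 4 + b - 1 / 4) * (r / (r + Γ)) *
            ((1 - a ^ i * (r / (r + Γ)) ^ i) / (1 - a * (r / (r + Γ)))) := by
  have hγ1 : r / (r + Γ) ≤ 1 := (div_le_one (by linarith)).2 (by linarith)
  have hγ0 : 0 < r / (r + Γ) := div_pos hr (by linarith)
  induction i with
  | zero =>
    obtain ⟨h1, h2⟩ := levelFidelity_zero_average hr hΓ J ρ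
    refine ⟨h1, h2.trans ?_⟩
    simp
    ring
  | succ i ih =>
    obtain ⟨h1, h2⟩ := levelFidelity_succ_average hr hΓ hJ ih.1
    refine ⟨h1, h2.trans ?_⟩
    rw [ih.2]
    generalize r / (r + Γ) = γ at hγ1 hγ0
    -- Since `|a| ≤ 1` and `0 < γ ≤ 1`, this case forces `a = γ = 1`, and then the range condition
    -- forces `b = 0`. The last term vanishes, in agreement with division by zero being zero.
    by_cases hone : 1 - a * γ = 0
    · have ha := abs_le.1 (abs_slope_le_one hJr)
      have ha1 : a = 1 := by nlinarith
      have hb0 := (hJr 0 (by simp)).1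
      have hb1 := (hJr 1 (by simp)).2
      have hb : b = 0 := by rw [ha1] at hb0 hb1; linarith
      have hγ : γ = 1 := by rw [ha1] at hone; linarith
      rw [ha1, hb, hγ]
      norm_num
    · have hgeom : (1 - a ^ (i + 1) * γ ^ (i + 1)) / (1 - a * γ) =
          1 + a * γ * ((1 - a ^ i * γ ^ i) / (1 - a * γ)) := by
        rw [div_eq_iff hone, add_mul, mul_assoc (a * γ), div_mul_cancel₀ _ hone]
        ring
      rw [hgeom]
      ring

end LevelAverage

/-! ### The conditional mean and its limit. -/

section Limit

variable {Ω : Type*} [MeasurableSpace Ω] {P : Measure Ω} [IsProbabilityMeasure P]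
  {Y : ℕ → Ω → Option ℕ} {H : ℕ → Ω → ℝ} {lam mu q p : ℝ} {Γ a b : ℝ}
  {J : ℝ → TwoQubitState → ℝ} {ρ : TwoQubitState}

/-- Integrability is required at every real `t`. Before time `0` the set in `jumpCount` is empty and
its `sSup` is `0`, so the state is the initial, empty one. -/
lemma ae_systemFidelity_of_neg (hsys : Is1G1B lam mu q p P Y H) (hlam : 0 < lam)
    (hα : 0 < mu + lam * q) {t : ℝ} (ht : t < 0) :
    systemFidelity Γ J ρ Y H t =ᵐ[P] 0 := by
  have hR := exitRate_pos (p := p) hlam hα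
  filter_upwards [IsCTMC.ae_nonneg hsys hR, IsCTMC.ae_start hsys hR] with ω hH h0
  have hN : jumpCount H t ω = 0 := by
    have : {n | jumpTime H n ω ≤ t} = ∅ := by
      refine Set.eq_empty_of_forall_notMem fun n hn => ?_
      have h1 : jumpTime H 0 ω ≤ jumpTime H n ω := monotone_jumpTime hH (Nat.zero_le n)
      have h2 : jumpTime H 0 ω = 0 := by simp [jumpTime]
      have h3 : jumpTime H n ω ≤ t := hn
      linarith
    rw [jumpCount, this]
    simp
  have hs : stateAt Y H t ω = none := by rw [stateAt, hN, h0]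
  unfold systemFidelity
  rw [hs]
  rfl

section

variable (hsys : Is1G1B lam mu q p P Y H) (hlam : 0 < lam) (hα : 0 < mu + lam * q)
  (hβ : 0 ≤ mu + lam * q * (1 - p)) (hν : 0 ≤ lam * q * p)

include hsys hlam hα hβ hν

lemma integrable_systemFidelity (hΓ : 0 ≤ Γ) (hJ : ∀ F, J F ρ = a * F + b)
    (hJr : ∀ F ∈ Set.Icc (0 : ℝ) 1, a * F + b ∈ Set.Icc 0 1) (t : ℝ) :
    Integrable (systemFidelity Γ J ρ Y H t) P := by
  have hR := exitRate_pos (p := p) hlam hα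
  rcases lt_or_ge t 0 with ht | ht
  · exact (integrable_zero _ _ _).congr (ae_systemFidelity_of_neg hsys hlam hα ht).symm
  have hex := ae_exists_currentJump hsys hlam hα hβ hν ht
  have hH := IsCTMC.ae_nonneg hsys hR
  have hY := ae_isBufferPath hsys hlam hα
  have huniv : P.restrict (⋃ n, currentJump H n t) = P := by
    refine Measure.restrict_eq_self_of_ae_mem ?_
    filter_upwards [hex] with ω hω
    exact Set.mem_iUnion.2 hω
  refine Integrable.of_bound (C := max (1 / 2) |ρ.fidelity - 1 / 2| + 1 / 2) ?_ ?_
  -- Measurability is checked on each event `currentJump H n t`, where the fidelity has an explicit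
  -- formula; almost surely these events cover everything.
  · rw [← huniv, aestronglyMeasurable_iUnion_iff]
    intro n
    have hG : Measurable (entryFidelity Γ a b ρ.fidelity Y H n) :=
      (measurable_hist_entryFidelity Γ a b ρ.fidelity Y H n).mono (IsCTMC.hist_le hsys n) le_rfl
    have hT := IsCTMC.measurable_jumpTime hsys n
    have hm : Measurable fun ω => if Y n ω = none then 0 else
        depol Γ (t - jumpTime H n ω) (entryFidelity Γ a b ρ.fidelity Y H n ω) :=
      Measurable.ite (IsCTMC.measurableSet_Y hsys n none) measurable_const
        (by unfold depol; fun_prop)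
    refine hm.aestronglyMeasurable.congr ?_
    filter_upwards [ae_restrict_mem (IsCTMC.measurableSet_currentJump hsys n t),
      ae_restrict_of_ae hH, ae_restrict_of_ae hY] with ω h1 h2 h3
    exact (systemFidelity_eq hJ h2 h3 h1).symm
  · filter_upwards [hex, hH, hY] with ω ⟨n, hn⟩ h2 h3
    rw [systemFidelity_eq hJ h2 h3 hn, Real.norm_eq_abs]
    have hpos : (1 / 2 : ℝ) ≤ max (1 / 2) |ρ.fidelity - 1 / 2| := le_max_left _ _
    split_ifs
    · rw [abs_zero]
      linarith
    · have hb := abs_depol_sub_half_le hΓ (sub_nonneg.2 hn.1) hpos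
        (abs_entryFidelity_sub_half_le (Y := Y) (H := H) (F₀ := ρ.fidelity) hΓ hJr n ω)
      rw [abs_le] at hb ⊢
      constructor <;> linarith

/-- Up to a null set, having a link at time `t` is the disjoint union over `n` of having one after
exactly `n` jumps. Its probability and the integral of the fidelity over it are then the sums of the
kernels. -/
lemma condMeanFidelity_eq (hΓ : 0 ≤ Γ) (hJ : ∀ F, J F ρ = a * F + b)
    (hJr : ∀ F ∈ Set.Icc (0 : ℝ) 1, a * F + b ∈ Set.Icc 0 1) {t : ℝ} (ht : 0 ≤ t) :
    condMeanFidelity Γ J ρ P Y H t =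
      (totalLink P (mu + lam * q) Y H t)⁻¹ *
        (totalExcess P (mu + lam * q) Γ a b ρ.fidelity Y H t +
          1 / 4 * totalLink P (mu + lam * q) Y H t) := by
  have hR := exitRate_pos (p := p) hlam hα
  have hex := ae_exists_currentJump hsys hlam hα hβ hν ht
  have hH := IsCTMC.ae_nonneg hsys hR
  have hY := ae_isBufferPath hsys hlam hα
  have hset : {ω | stateAt Y H t ω ≠ none} =ᵐ[P]
      ⋃ n, {ω | Y n ω ≠ none} ∩ currentJump H n t := by
    filter_upwards [hex, hH] with ω ⟨n, hn⟩ h2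
    refine propext ?_
    change stateAt Y H t ω ≠ none ↔ ω ∈ ⋃ n, {ω | Y n ω ≠ none} ∩ currentJump H n t
    rw [Set.mem_iUnion]
    constructor
    · intro h
      refine ⟨n, ?_, hn⟩
      rwa [stateAt, jumpCount_eq h2 hn] at h
    · rintro ⟨m, hm, hm'⟩
      rwa [stateAt, jumpCount_eq h2 hm']
  have hm : ∀ n, MeasurableSet ({ω | Y n ω ≠ none} ∩ currentJump H n t) := fun n =>
    (IsCTMC.measurableSet_mem hsys n {none}ᶜ).inter (IsCTMC.measurableSet_currentJump hsys n t)
  have hdisj : Pairwise (Function.onFun (AEDisjoint P)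
      fun n => {ω | Y n ω ≠ none} ∩ currentJump H n t) := fun m n hmn =>
    (IsCTMC.aedisjoint_currentJump hsys hR t hmn).mono Set.inter_subset_right
      Set.inter_subset_right
  have hL := (summable_linkMean hsys hlam hα hβ hν t).1.of_abs
  have hM := (summable_excessMean (F₀ := ρ.fidelity) hsys hlam hα hβ hν hΓ hJr t).1.of_abs
  have hPA : (P {ω | stateAt Y H t ω ≠ none}).toReal = totalLink P (mu + lam * q) Y H t := by
    rw [measure_congr hset, measure_iUnion₀ hdisj fun n => (hm n).nullMeasurableSet,
      ENNReal.tsum_toReal_eq fun n => measure_ne_top _ _, totalLink]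
    exact tsum_congr fun n => (linkMean_eq hsys hlam hα hβ hν n t).symm
  have hint : ∫ ω in {ω | stateAt Y H t ω ≠ none}, systemFidelity Γ J ρ Y H t ω ∂P =
      totalExcess P (mu + lam * q) Γ a b ρ.fidelity Y H t +
          1 / 4 * totalLink P (mu + lam * q) Y H t := by
    rw [setIntegral_congr_set hset, integral_iUnion_ae (fun n => (hm n).nullMeasurableSet) hdisj
      (integrable_systemFidelity hsys hlam hα hβ hν hΓ hJ hJr t).integrableOn, totalExcess,
      totalLink, ← tsum_mul_left, ← hM.tsum_add (hL.mul_left _)]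
    refine tsum_congr fun n => ?_
    rw [← excessMean_eq hsys hlam hα hβ hν hΓ hJr]
    refine setIntegral_congr_ae (hm n) ?_
    filter_upwards [hH, hY] with ω h2 h3 hω
    rw [systemFidelity_eq hJ h2 h3 hω.2, if_neg hω.1]
  rw [condMeanFidelity, ProbabilityTheory.cond, integral_smul_measure, hint, ENNReal.toReal_inv,
    hPA, smul_eq_mul]

lemma tendsto_condMeanFidelity (hβ' : 0 < mu + lam * q * (1 - p)) (hΓ : 0 ≤ Γ)
    (hJ : ∀ F, J F ρ = a * F + b)
    (hJr : ∀ F ∈ Set.Icc (0 : ℝ) 1, a * F + b ∈ Set.Icc 0 1) :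
    Filter.Tendsto (condMeanFidelity Γ J ρ P Y H) Filter.atTop
      (nhds ((1 / 4 * Γ + b * lam * q * p + ρ.fidelity * (mu + lam * q * (1 - p))) /
        (Γ + mu + lam * q * (1 - p * a)))) := by
  have ha := abs_le.1 (abs_slope_le_one hJr)
  have hOm := measurable_totalEmpty hsys hlam hα hβ hν
  have hLm := measurable_totalLink hsys hlam hα hβ hν
  have hOa := abs_totalEmpty_le hsys hlam hα hβ hν
  have hLa := abs_totalLink_le hsys hlam hα hβ hν
  have hOL := fun t ht => (totalEmpty_add_totalLink hsys hlam hα hβ hν (t := t) ht).1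
  have hL := tendsto_occupation hlam hα hβ' (ν := lam * q * p) (by ring) hOm hLm hOa hLa hOL
    (isResponse_totalLink hsys hlam hα hβ hν)
  have hO : Filter.Tendsto (totalEmpty P lam Y H) Filter.atTop
      (nhds (1 - lam / (lam + (mu + lam * q * (1 - p))))) := by
    refine (hL.const_sub 1).congr' ?_
    filter_upwards [Filter.eventually_ge_atTop 0] with t ht
    linarith [hOL t ht]
  -- As `a ≤ 1`, this is at least `β + Γ`, which is positive.
  have hD : 0 < mu + lam * q + Γ - lam * q * p * a := by nlinarith
  have hM := tendsto_mean (K := max (1 / 2) |ρ.fidelity - 1 / 2| + 1 / 4)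
    (by linarith : 0 < mu + lam * q + Γ) hD hOm hLm
    (measurable_totalExcess (F₀ := ρ.fidelity) hsys hlam hα hβ hν hΓ hJr) hOa hLa
    (fun s => abs_tsum_le_of_summable_abs (summable_excessMean hsys hlam hα hβ hν hΓ hJr s).1
      (summable_excessMean hsys hlam hα hβ hν hΓ hJr s).2) hO hL
    (isResponse_totalExcess hsys hlam hα hβ hν hΓ hJr)
  have hs : 0 < lam + (mu + lam * q * (1 - p)) := by linarith
  have hpos : lam / (lam + (mu + lam * q * (1 - p))) ≠ 0 := (div_pos hlam hs).ne'
  have h := (hL.inv₀ hpos).mul (hM.add (hL.const_mul (1 / 4)))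
  have hval : (lam / (lam + (mu + lam * q * (1 - p))))⁻¹ *
      ((lam * (ρ.fidelity - 1 / 4) * (1 - lam / (lam + (mu + lam * q * (1 - p)))) +
        lam * q * p * (a / 4 + b - 1 / 4) * (lam / (lam + (mu + lam * q * (1 - p))))) /
          (mu + lam * q + Γ - lam * q * p * a) +
        1 / 4 * (lam / (lam + (mu + lam * q * (1 - p))))) =
      (1 / 4 * Γ + b * lam * q * p + ρ.fidelity * (mu + lam * q * (1 - p))) /
        (Γ + mu + lam * q * (1 - p * a)) := by
    have hD' : Γ + mu + lam * q * (1 - p * a) = mu + lam * q + Γ - lam * q * p * a := by ring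
    rw [hD']
    -- Trading `Γ` for the denominator `D` makes `D` an atom, so that clearing denominators leaves a
    -- polynomial identity.
    generalize hDD : mu + lam * q + Γ - lam * q * p * a = D at hD
    have hΓD : Γ = D - (mu + lam * q - lam * q * p * a) := by rw [← hDD]; ring
    rw [hΓD]
    have := hs.ne'
    have := hD.ne'
    have := hlam.ne'
    field_simp
    ring
  rw [hval] at h
  refine h.congr' ?_
  filter_upwards [Filter.eventually_ge_atTop 0] with t ht
  exact (condMeanFidelity_eq hsys hlam hα hβ hν hΓ hJ hJr ht).symm

end

end Limit

end Buffer

end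

theorem lemma1 {Ω : Type*} [MeasurableSpace Ω] (P : Measure Ω) [IsProbabilityMeasure P]
    (lam mu q p Γ : ℝ) (hlam : 0 < lam) (hmu : 0 < mu) (hq : q ∈ Set.Icc (0 : ℝ) 1)
    (hp : p ∈ Set.Icc (0 : ℝ) 1) (hΓ : 0 ≤ Γ)
    (Y : ℕ → Ω → Option ℕ) (H : ℕ → Ω → ℝ) (hsys : Buffer.Is1G1B lam mu q p P Y H)
    (ρ : Buffer.TwoQubitState) (J : ℝ → Buffer.TwoQubitState → ℝ) (a b : ℝ)
    (hJ : ∀ F, J F ρ = a * F + b)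
    (hJrange : ∀ F ∈ Set.Icc (0 : ℝ) 1, J F ρ ∈ Set.Icc (0 : ℝ) 1)
    (α γ : ℝ) (hα : α = mu + lam * q) (hγ : γ = α / (α + Γ)) :
    (∀ i : ℕ,
      Integrable (Buffer.levelFidelity Γ J ρ i) (Buffer.iidExp (mu + lam * q) i) ∧
      Buffer.avgLevelFidelity lam mu q Γ J ρ i =
        1 / 4 + (ρ.fidelity - 1 / 4) * a ^ i * γ ^ (i + 1) +
          (a / 4 + b - 1 / 4) * γ * ((1 - a ^ i * γ ^ i) / (1 - a * γ))) ∧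
    Buffer.IsAvgConsumedFidelity Γ J ρ P Y H
      ((1 / 4 * Γ + b * lam * q * p + ρ.fidelity * (mu + lam * q * (1 - p))) /
        (Γ + mu + lam * q * (1 - p * a))) := by
  have hJr : ∀ F ∈ Set.Icc (0 : ℝ) 1, a * F + b ∈ Set.Icc (0 : ℝ) 1 := fun F hF => by
    rw [← hJ]
    exact hJrange F hF
  have hlq : 0 ≤ lam * q := mul_nonneg hlam.le hq.1
  have hα0 : 0 < mu + lam * q := by linarith
  have hβ : 0 < mu + lam * q * (1 - p) :=
    add_pos_of_pos_of_nonneg hmu (mul_nonneg hlq (sub_nonneg.2 hp.2))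
  have hν : 0 ≤ lam * q * p := mul_nonneg hlq hp.1
  refine ⟨fun i => ?_, fun t => ?_, ?_⟩
  · rw [hγ, hα]
    exact Buffer.levelFidelity_average hα0 hΓ hJ hJr i
  · exact Buffer.integrable_systemFidelity hsys hlam hα0 hβ.le hν hΓ hJ hJr t
  · exact Buffer.tendsto_condMeanFidelity hsys hlam hα0 hβ.le hν hβ hΓ hJ hJr
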